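/- Words are elements of the free semigroup $\mathfrak A^+$ over a countably infinite alphabet $\mathfrak A$ of variables. A variable is linear in a word $\mathbf u$ if it occurs in $\mathbf u$ exactly once, and non-linear if it occurs more than once; $\mathrm{lin}(\mathbf u)$ is the set of linear variables of $\mathbf u$. For a set $X$ of variables, $\mathbf u(X)$ is the (possibly empty) word obtained from $\mathbf u$ by deleting all occurrences of variables not in $X$. A word is almost-linear if it has at most one non-linear variable; an identity $\mathbf u\approx\mathbf v$ is almost-linear if both $\mathbf u$ and $\mathbf v$ are. An identity $\mathbf u\approx\mathbf v$ is block-balanced if $\mathbf u(\{x\}\cup\mathrm{lin}(\mathbf u))=\mathbf v(\{x\}\cup\mathrm{lin}(\mathbf u))$ for every variable $x$. A word $\mathbf u$ is an isoterm for a semigroup $S$ if $S$ satisfies no identity $\mathbf u\approx\mathbf v$ with $\mathbf v\neq\mathbf u$. A pair $\{x,y\}$ of variables is b-unstable in $\mathbf u$ with respect to $S$ if $S$ satisfies a block-balanced identity $\mathbf u\approx\mathbf v$ with $\mathbf u(\{x,y\})\neq\mathbf v(\{x,y\})$. Let $\sigma_1$ be the identity $xyt_1xt_2y\approx yxt_1xt_2y$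 and $\sigma_2$ the identity $xt_1yt_2xy\approx xt_1yt_2yx$. **Theorem.** Let $S$ be a monoid satisfying $\sigma_1$ and $\sigma_2$. Suppose that for some $m>0$ the word $x^my^m$ (with $x\ne y$) is an isoterm for $S$ and that for some $0<d\le m$ the monoid $S$ satisfies either $$x^{m+1-d}t_1x^dyt_2y\approx x^{m+1-d}t_1x^{d-1}yxt_2y$$ or $$xt_1xy^dt_2y^{m+1-d}\approx xt_1yxy^{d-1}t_2y^{m+1-d},$$ where $x,y,t_1,t_2$ are distinct variables. If $m>1$, suppose moreover that for every $1<k\le m$ both of the following conditions hold, where $x,y,t$ are distinct variables: (i) for every word $\mathbf A$ not containing $y$ or $t$ such that $x$ occurs in $\mathbf A$ and $\mathbf Ax$ is almost-linear, if $\{x,y\}$ is b-unstable in $\mathbf Axy^k$ with respect to $S$, then for some $0<c<k$ the monoid $S$ satisfies $\mathbf Axy^cty^{k-c}\approx \mathbf Ayxy^{c-1}ty^{k-c}$; (ii) for every word $\mathbf B$ not containing $x$ or $t$ such that $y$ occurs in $\mathbf B$ and $y\mathbf B$ is almost-linear, if $\{x,y\}$ is b-unstable in $x^ky\mathbf B$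 with respect to $S$, then for some $0<p<k$ the monoid $S$ satisfies $x^{k-p}tx^py\mathbf B\approx x^{k-p}tx^{p-1}yx\mathbf B$. Then $S$ is finitely based by almost-linear identities and block-balanced identities with two non-linear variables: there is a finite set $\Sigma$ of identities of $S$, each of which is either almost-linear or is block-balanced with exactly two non-linear variables, such that every identity $\mathbf u\approx\mathbf v$ ($\mathbf u,\mathbf v\in\mathfrak A^+$) satisfied by $S$ can be derived from $\Sigma$ (as a semigroup identity). -/

import Mathlib

namespace WordIdentities

/-- Words over the countably infinite alphabet `ℕ` of variables. Elements of the free semigroup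
are the nonempty words; deleting variables may produce the empty word. -/
abbrev Word : Type := List ℕ

/-- The word `x ^ n`. -/
abbrev pw (x n : ℕ) : Word := List.replicate n x

/-- The variables occurring exactly once in `u`. -/
def lin (u : Word) : Finset ℕ := u.toFinset.filter fun x => u.count x = 1

/-- The variables occurring more than once in `u`. -/
def nonlin (u : Word) : Finset ℕ := u.toFinset.filter fun x => 1 < u.count x

/-- `u(X)`: delete from `u` all occurrences of all variables that are not in `X`. -/
def restrict (X : Finset ℕ) (u : Word) : Word := u.filter fun x => decide (x ∈ X)

/-- A word is almost-linear if it has at most one non-linear variable. -/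
def AlmostLinear (u : Word) : Prop := (nonlin u).card ≤ 1

/-- The identity `u ≈ v` is block-balanced: `u(x, lin u) = v(x, lin u)` for every variable `x`. -/
def BlockBalanced (u v : Word) : Prop :=
  ∀ x : ℕ, restrict (insert x (lin u)) u = restrict (insert x (lin u)) v

/-- The monoid `S` satisfies the identity `u ≈ v`. -/
def Satisfies (S : Type*) [Monoid S] (u v : Word) : Prop :=
  ∀ φ : ℕ → S, (u.map φ).prod = (v.map φ).prod

/-- The equational theory of `S`, as a semigroup: all identities between nonempty words
that hold in `S`. -/
def equationalTheory (S : Type*) [Monoid S] : Set (Word × Word) :=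
  {p | p.1 ≠ [] ∧ p.2 ≠ [] ∧ Satisfies S p.1 p.2}

/-- `u` is an isoterm for `S`: no nontrivial identity `u ≈ v` holds in `S`. -/
def Isoterm (S : Type*) [Monoid S] (u : Word) : Prop :=
  ∀ v : Word, v ≠ [] → Satisfies S u v → u = v

/-- The pair `{x, y}` is b-unstable in `u` with respect to `S`: a block-balanced identity `u ≈ v`
with `u(x, y) ≠ v(x, y)` holds in `S`. -/
def BUnstable (S : Type*) [Monoid S] (x y : ℕ) (u : Word) : Prop :=
  ∃ v : Word, v ≠ [] ∧ Satisfies S u v ∧ BlockBalanced u v ∧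
    restrict {x, y} u ≠ restrict {x, y} v

/-- Derivability of semigroup identities: `Derives E u v` says that `u` can be transformed into `v`
by finitely many replacements (in either direction) of a subword `θ(p)` by `θ(q)`, where `p ≈ q` is
in `E` and `θ` substitutes nonempty words for variables. -/
inductive Derives (E : Set (Word × Word)) : Word → Word → Prop
  | step (p q : Word) (h : (p, q) ∈ E) (θ : ℕ → Word) (hθ : ∀ x, θ x ≠ []) (a b : Word) :
      Derives E (a ++ p.flatMap θ ++ b) (a ++ q.flatMap θ ++ b)
  | refl (u : Word) : Derives E u u
  | symm {u v : Word} : Derives E u v → Derives E v u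
  | trans {u v w : Word} : Derives E u v → Derives E v w → Derives E u w

/-- `E` is a finite basis of identities of `S`. -/
def IsFiniteBasis (S : Type*) [Monoid S] (E : Set (Word × Word)) : Prop :=
  E.Finite ∧ E ⊆ equationalTheory S ∧ ∀ p ∈ equationalTheory S, Derives E p.1 p.2

/-- `σ₁`: `x y t₁ x t₂ y ≈ y x t₁ x t₂ y`, with `x, y, t₁, t₂ = 0, 1, 2, 3`. -/
def SatSigma1 (S : Type*) [Monoid S] : Prop := Satisfies S [0, 1, 2, 0, 3, 1] [1, 0, 2, 0, 3, 1]

/-- `σ₂`: `x t₁ y t₂ x y ≈ x t₁ y t₂ y x`, with `x, y, t₁, t₂ = 0, 1, 2, 3`. -/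
def SatSigma2 (S : Type*) [Monoid S] : Prop := Satisfies S [0, 2, 1, 3, 0, 1] [0, 2, 1, 3, 1, 0]

/-- For every almost-linear word `A x` with `x` occurring in `A` such that `{x, y}` is b-unstable in
`A x y^k`, there is `0 < c < k` such that `S` satisfies
`A x y^c t y^(k-c) ≈ A y x y^(c-1) t y^(k-c)`. Here `y` and `t` are new variables. -/
def CondI (S : Type*) [Monoid S] (k : ℕ) : Prop :=
  ∀ (A : Word) (x y t : ℕ), x ≠ y → t ≠ x → t ≠ y → y ∉ A → t ∉ A →
    x ∈ A → AlmostLinear (A ++ [x]) → BUnstable S x y (A ++ [x] ++ pw y k) →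
    ∃ c, 0 < c ∧ c < k ∧
      Satisfies S (A ++ [x] ++ pw y c ++ [t] ++ pw y (k - c))
        (A ++ [y, x] ++ pw y (c - 1) ++ [t] ++ pw y (k - c))

/-- The dual condition: for every almost-linear word `y B` with `y` occurring in `B` such that
`{x, y}` is b-unstable in `x^k y B`, there is `0 < p < k` such that `S` satisfies
`x^(k-p) t x^p y B ≈ x^(k-p) t x^(p-1) y x B`. Here `x` and `t` are new variables. -/
def CondII (S : Type*) [Monoid S] (k : ℕ) : Prop :=
  ∀ (B : Word) (x y t : ℕ), x ≠ y → t ≠ x → t ≠ y → x ∉ B → t ∉ B →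
    y ∈ B → AlmostLinear ([y] ++ B) → BUnstable S x y (pw x k ++ [y] ++ B) →
    ∃ p, 0 < p ∧ p < k ∧
      Satisfies S (pw x (k - p) ++ [t] ++ pw x p ++ [y] ++ B)
        (pw x (k - p) ++ [t] ++ pw x (p - 1) ++ [y, x] ++ B)

end WordIdentities

namespace WordIdentities

section Derivations

variable {E F : Set (Word × Word)} {u v w : Word}

theorem Derives.context (h : Derives E u v) (a b : Word) :
    Derives E (a ++ u ++ b) (a ++ v ++ b) := by
  induction h with
  | step p q h θ hθ c e =>
    have := Derives.step p q h θ hθ (a ++ c) (e ++ b)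
    simpa [List.append_assoc] using this
  | refl u => exact .refl _
  | symm _ ih => exact ih.symm
  | trans _ _ ih1 ih2 => exact ih1.trans ih2

theorem Derives.flatMap (h : Derives E u v) (η : ℕ → Word) (hη : ∀ x, η x ≠ []) :
    Derives E (u.flatMap η) (v.flatMap η) := by
  induction h with
  | step p q h θ hθ c e =>
    have := Derives.step p q h (fun x => (θ x).flatMap η) (fun x => by
      obtain ⟨y, ys, h'⟩ := List.exists_cons_of_ne_nil (hθ x)
      simp [h', hη]) (c.flatMap η) (e.flatMap η)
    simpa [List.flatMap_append, List.flatMap_assoc] using this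
  | refl u => exact .refl _
  | symm _ ih => exact ih.symm
  | trans _ _ ih1 ih2 => exact ih1.trans ih2

theorem Derives.mono (h : Derives E u v) (hEF : E ⊆ F) : Derives F u v := by
  induction h with
  | step p q h θ hθ c e => exact .step p q (hEF h) θ hθ c e
  | refl u => exact .refl _
  | symm _ ih => exact ih.symm
  | trans _ _ ih1 ih2 => exact ih1.trans ih2

theorem Derives.of_mem {p q : Word} (h : (p, q) ∈ E) (θ : ℕ → Word) (hθ : ∀ x, θ x ≠ []) :
    Derives E (p.flatMap θ) (q.flatMap θ) := by
  simpa using Derives.step p q h θ hθ [] []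

theorem Derives.reverse (h : Derives E u v) :
    Derives ((fun p : Word × Word => (p.1.reverse, p.2.reverse)) '' E) u.reverse v.reverse := by
  induction h with
  | step p q h θ hθ c e =>
    have := Derives.step (E := (fun p : Word × Word => (p.1.reverse, p.2.reverse)) '' E)
      p.reverse q.reverse ⟨(p, q), h, rfl⟩ (fun x => (θ x).reverse) (by simpa using hθ)
      e.reverse c.reverse
    have key : ∀ r : Word, r.reverse.flatMap (fun x => (θ x).reverse) = (r.flatMap θ).reverse := by
      intro r
      rw [List.reverse_flatMap]
      rfl
    simpa [key, List.append_assoc] using this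
  | refl u => exact .refl _
  | symm _ ih => exact ih.symm
  | trans _ _ ih1 ih2 => exact ih1.trans ih2

end Derivations

section Satisfaction

variable {S : Type*} [Monoid S] {u v w : Word}

theorem Satisfies.refl (u : Word) : Satisfies S u u := fun _ => rfl

theorem Satisfies.symm (h : Satisfies S u v) : Satisfies S v u := fun φ => (h φ).symm

theorem Satisfies.trans (h : Satisfies S u v) (h' : Satisfies S v w) : Satisfies S u w :=
  fun φ => (h φ).trans (h' φ)

theorem Satisfies.context (h : Satisfies S u v) (a b : Word) :
    Satisfies S (a ++ u ++ b) (a ++ v ++ b) := by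
  intro φ
  simp [h φ]

theorem prod_map_flatMap (u : Word) (θ : ℕ → Word) (φ : ℕ → S) :
    ((u.flatMap θ).map φ).prod = (u.map fun x => ((θ x).map φ).prod).prod := by
  induction u with
  | nil => simp
  | cons a u ih => simp [ih]

theorem Satisfies.flatMap (h : Satisfies S u v) (θ : ℕ → Word) :
    Satisfies S (u.flatMap θ) (v.flatMap θ) := by
  intro φ
  rw [prod_map_flatMap, prod_map_flatMap]
  exact h _

theorem flatMap_ite_eq_restrict (X : Finset ℕ) (u : Word) :
    u.flatMap (fun x => if x ∈ X then [x] else []) = restrict X u := by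
  induction u with
  | nil => simp [restrict]
  | cons a u ih =>
    simp only [List.flatMap_cons, ih, restrict, List.filter_cons]
    by_cases h : a ∈ X <;> simp [h]

theorem Satisfies.restrict (h : Satisfies S u v) (X : Finset ℕ) :
    Satisfies S (restrict X u) (restrict X v) := by
  rw [← flatMap_ite_eq_restrict, ← flatMap_ite_eq_restrict]
  exact h.flatMap _

theorem Satisfies.map (h : Satisfies S u v) (f : ℕ → ℕ) : Satisfies S (u.map f) (v.map f) := by
  intro φ
  simpa using h (φ ∘ f)

theorem Derives.sound {E : Set (Word × Word)} (hE : E ⊆ equationalTheory S) (h : Derives E u v) :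
    Satisfies S u v := by
  induction h with
  | step p q h θ hθ a b => exact ((hE h).2.2.flatMap θ).context a b
  | refl u => exact .refl _
  | symm _ ih => exact ih.symm
  | trans _ _ ih1 ih2 => exact ih1.trans ih2

end Satisfaction

section Restriction

variable {X Y : Finset ℕ} {u v w : Word} {x y z : ℕ}

@[simp] theorem restrict_nil : restrict X [] = [] := rfl

@[simp] theorem restrict_append : restrict X (u ++ v) = restrict X u ++ restrict X v :=
  List.filter_append ..

theorem restrict_cons_of_mem (h : x ∈ X) : restrict X (x :: u) = x :: restrict X u := by
  simp [restrict, h]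

theorem restrict_cons_of_not_mem (h : x ∉ X) : restrict X (x :: u) = restrict X u := by
  simp [restrict, h]

theorem mem_restrict : x ∈ restrict X u ↔ x ∈ u ∧ x ∈ X := by
  simp [restrict]

theorem restrict_restrict : restrict X (restrict Y u) = restrict (X ∩ Y) u := by
  simp only [restrict, List.filter_filter]
  congr 1
  funext a
  simp

theorem restrict_restrict_of_subset (h : X ⊆ Y) : restrict X (restrict Y u) = restrict X u := by
  rw [restrict_restrict, Finset.inter_eq_left.2 h]

theorem restrict_eq_of_subset (h : X ⊆ Y) (e : restrict Y u = restrict Y v) :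
    restrict X u = restrict X v := by
  rw [← restrict_restrict_of_subset h, e, restrict_restrict_of_subset h]

theorem count_restrict_of_mem (h : x ∈ X) : (restrict X u).count x = u.count x := by
  rw [restrict, List.count_filter]
  simpa using h

theorem count_restrict_of_not_mem (h : x ∉ X) : (restrict X u).count x = 0 := by
  rw [List.count_eq_zero]
  simp [mem_restrict, h]

theorem restrict_eq_nil_iff : restrict X u = [] ↔ ∀ x ∈ u, x ∉ X := by
  simp [restrict]

theorem restrict_congr (h : ∀ x ∈ u, (x ∈ X ↔ x ∈ Y)) : restrict X u = restrict Y u := by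
  unfold restrict
  apply List.filter_congr
  intro x hx
  simp [h x hx]

theorem restrict_eq_self (h : ∀ x ∈ u, x ∈ X) : restrict X u = u := by
  simpa [restrict] using h

theorem restrict_eq_pw (h : ∀ z ∈ u, z ∈ X → z = x) (hx : x ∈ X) :
    restrict X u = pw x (u.count x) := by
  rw [pw, List.eq_replicate_iff]
  have hz : ∀ z ∈ restrict X u, z = x := fun z hz =>
    h z (mem_restrict.1 hz).1 (mem_restrict.1 hz).2
  refine ⟨?_, hz⟩
  rw [← count_restrict_of_mem hx (u := u)]
  symm
  rw [List.count_eq_length]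
  exact fun b hb => (hz b hb).symm

/-- A word is determined by its restrictions to pairs of variables. -/
theorem eq_of_restrict_pair_eq (h : ∀ x y, restrict {x, y} u = restrict {x, y} v) : u = v := by
  induction u generalizing v with
  | nil =>
    cases v with
    | nil => rfl
    | cons b v =>
      have := h b b
      rw [restrict_cons_of_mem (by simp)] at this
      simp at this
  | cons a u ih =>
    cases v with
    | nil =>
      have := h a a
      rw [restrict_cons_of_mem (by simp)] at this
      simp at this
    | cons b v =>
      have h0 := h a b
      rw [restrict_cons_of_mem (by simp), restrict_cons_of_mem (by simp)] at h0
      obtain ⟨rfl, -⟩ := List.cons.inj h0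
      congr 1
      apply ih
      intro x y
      have := h x y
      by_cases hx : a ∈ ({x, y} : Finset ℕ)
      · rw [restrict_cons_of_mem hx, restrict_cons_of_mem hx] at this
        exact (List.cons.inj this).2
      · rwa [restrict_cons_of_not_mem hx, restrict_cons_of_not_mem hx] at this

theorem restrict_eq_of_pairs (h : ∀ x ∈ X, ∀ y ∈ X, restrict {x, y} u = restrict {x, y} v) :
    restrict X u = restrict X v := by
  apply eq_of_restrict_pair_eq
  intro x y
  rw [restrict_restrict, restrict_restrict]
  by_cases hx : x ∈ X
  · by_cases hy : y ∈ X
    · exact restrict_eq_of_subset Finset.inter_subset_left (h x hx y hy)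
    · apply restrict_eq_of_subset _ (h x hx x hx)
      intro z
      simp only [Finset.mem_inter, Finset.mem_insert, Finset.mem_singleton]
      rintro ⟨rfl | rfl, hz⟩
      · simp
      · exact absurd hz hy
  · by_cases hy : y ∈ X
    · apply restrict_eq_of_subset _ (h y hy y hy)
      intro z
      simp only [Finset.mem_inter, Finset.mem_insert, Finset.mem_singleton]
      rintro ⟨rfl | rfl, hz⟩
      · exact absurd hz hx
      · simp
    · have : ({x, y} : Finset ℕ) ∩ X = ∅ := by
        ext z
        simp only [Finset.mem_inter, Finset.mem_insert, Finset.mem_singleton, Finset.notMem_empty,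
          iff_false]
        rintro ⟨rfl | rfl, hz⟩
        · exact hx hz
        · exact hy hz
      rw [this, restrict_eq_nil_iff.2 (by simp), restrict_eq_nil_iff.2 (by simp)]

theorem mem_lin : x ∈ lin u ↔ u.count x = 1 := by
  simp only [lin, Finset.mem_filter, List.mem_toFinset, and_iff_right_iff_imp]
  intro h
  exact List.count_pos_iff.1 (by omega)

theorem mem_nonlin : x ∈ nonlin u ↔ 1 < u.count x := by
  simp only [nonlin, Finset.mem_filter, List.mem_toFinset, and_iff_right_iff_imp]
  intro h
  exact List.count_pos_iff.1 (by omega)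

theorem lin_eq_of_count_eq (h : ∀ z, u.count z = v.count z) : lin u = lin v := by
  ext z
  rw [mem_lin, mem_lin, h]

theorem BlockBalanced.count_eq (h : BlockBalanced u v) (z : ℕ) : u.count z = v.count z := by
  have := congrArg (List.count z) (h z)
  rwa [count_restrict_of_mem (by simp), count_restrict_of_mem (by simp)] at this

theorem BlockBalanced.lin_eq (h : BlockBalanced u v) : lin u = lin v :=
  lin_eq_of_count_eq h.count_eq

theorem BlockBalanced.symm (h : BlockBalanced u v) : BlockBalanced v u := by
  intro x
  rw [← h.lin_eq]
  exact (h x).symm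

theorem BlockBalanced.trans (h : BlockBalanced u v) (h' : BlockBalanced v w) :
    BlockBalanced u w := by
  intro x
  rw [h x, h.lin_eq]
  exact h' x

/-- Interchanging two adjacent occurrences of non-linear variables is block-balanced. -/
theorem blockBalanced_swap (P Q : Word) (hx : (P ++ [x, y] ++ Q).count x ≠ 1)
    (hy : (P ++ [x, y] ++ Q).count y ≠ 1) :
    BlockBalanced (P ++ [x, y] ++ Q) (P ++ [y, x] ++ Q) := by
  intro z
  have hx' : x ∉ lin (P ++ [x, y] ++ Q) := by rwa [mem_lin]
  have hy' : y ∉ lin (P ++ [x, y] ++ Q) := by rwa [mem_lin]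
  generalize lin (P ++ [x, y] ++ Q) = L at *
  simp only [restrict_append]
  congr 2
  by_cases hxz : x = z
  · by_cases hyz : y = z
    · rw [hxz, hyz]
    · have : y ∉ insert z L := by simp [hyz, hy']
      simp [restrict, List.filter_cons, hyz, hy']
  · simp [restrict, List.filter_cons, hxz, hx']

theorem BlockBalanced.restrict (h : BlockBalanced u v) (X : Finset ℕ) :
    BlockBalanced (restrict X u) (WordIdentities.restrict X v) := by
  intro z
  rw [restrict_restrict, restrict_restrict]
  apply restrict_eq_of_subset _ (h z)
  intro a
  simp only [Finset.mem_inter, Finset.mem_insert, mem_lin]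
  rintro ⟨rfl | ha, haX⟩
  · exact Or.inl rfl
  · rw [count_restrict_of_mem haX] at ha
    exact Or.inr ha

theorem BlockBalanced.perm (h : BlockBalanced u v) : u.Perm v :=
  List.perm_iff_count.2 h.count_eq

end Restriction

section Precedence

variable {u v w P Q : Word} {x y z : ℕ}

/-- All occurrences of `x` in `u` precede all occurrences of `y`. -/
def Precedes (x y : ℕ) (u : Word) : Prop :=
  restrict {x, y} u = pw x (u.count x) ++ pw y (u.count y)

theorem precedes_append (hy : y ∉ P) (hx : x ∉ Q) : Precedes x y (P ++ Q) := by
  rw [Precedes, restrict_append, restrict_eq_pw (u := P) (x := x), restrict_eq_pw (u := Q) (x := y),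
    List.count_append, List.count_append, List.count_eq_zero.2 hy, List.count_eq_zero.2 hx]
  · simp
  · intro z hz hz'
    simp only [Finset.mem_insert, Finset.mem_singleton] at hz'
    rcases hz' with rfl | rfl
    · exact absurd hz hx
    · rfl
  · simp
  · intro z hz hz'
    simp only [Finset.mem_insert, Finset.mem_singleton] at hz'
    rcases hz' with rfl | rfl
    · rfl
    · exact absurd hz hy
  · simp

theorem Precedes.not_mem (h : Precedes x y (P ++ Q)) (hxy : x ≠ y) (hy : y ∈ P) : x ∉ Q := by
  intro hx
  rw [Precedes, restrict_append, List.append_eq_append_iff] at h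
  have hy' : y ∈ restrict {x, y} P := mem_restrict.2 ⟨hy, by simp⟩
  have hx' : x ∈ restrict {x, y} Q := mem_restrict.2 ⟨hx, by simp⟩
  rcases h with ⟨as, h1, -⟩ | ⟨cs, -, h2⟩
  · have : y ∈ pw x (List.count x (P ++ Q)) := by rw [h1]; simp [hy']
    exact hxy (List.eq_of_mem_replicate this).symm
  · have : x ∈ pw y (List.count y (P ++ Q)) := by rw [h2]; simp [hx']
    exact hxy (List.eq_of_mem_replicate this)

theorem Precedes.congr (h : Precedes x y u) (e : restrict {x, y} u = restrict {x, y} v) :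
    Precedes x y v := by
  have hc := fun a => congrArg (List.count a) e
  have hx := hc x
  have hy := hc y
  rw [count_restrict_of_mem (by simp), count_restrict_of_mem (by simp)] at hx hy
  rw [Precedes, ← e, h, hx, hy]

theorem Precedes.restrict_eq (h : Precedes x y u) (h' : Precedes x y v)
    (e : ∀ z, u.count z = v.count z) : restrict {x, y} u = restrict {x, y} v := by
  rw [h, h', e, e]

end Precedence

section IsotermConsequences

variable {S : Type*} [Monoid S] {m : ℕ} {u v w : Word} {x y z : ℕ}

theorem Isoterm.pw_eq (hm : 0 < m) (hiso : Isoterm S (pw 0 m ++ pw 1 m)) {a b : ℕ} (ha : a ≤ m)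
    (hb : b ≤ m) (h : Satisfies S (pw 0 a ++ pw 1 b) w) : w = pw 0 a ++ pw 1 b := by
  have h1 := h.context (pw 0 (m - a)) (pw 1 (m - b))
  have e : pw 0 (m - a) ++ (pw 0 a ++ pw 1 b) ++ pw 1 (m - b) = pw 0 m ++ pw 1 m := by
    rw [← List.append_assoc, List.append_assoc]
    simp only [pw, List.replicate_append_replicate]
    congr 2 <;> omega
  have hne : pw 0 (m - a) ++ w ++ pw 1 (m - b) ≠ [] := by
    intro h0
    rw [h0, e] at h1
    have h2 : Satisfies S (pw 0 m ++ pw 1 m) ((pw 0 m ++ pw 1 m) ++ (pw 0 m ++ pw 1 m)) := by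
      intro φ
      have key : ∀ p : Word, (p.map φ).prod = 1 → (p.map φ).prod = ((p ++ p).map φ).prod := by
        intro p hp
        simp [hp]
      exact key _ (h1 φ)
    have h3 := congrArg List.length (hiso _ (by simp [pw]; omega) h2)
    simp only [pw, List.length_append, List.length_replicate] at h3
    omega
  rw [← e] at hiso
  have := hiso _ hne h1
  rw [List.append_cancel_right_eq, List.append_cancel_left_eq] at this
  exact this.symm

theorem Isoterm.count_eq (hm : 0 < m) (hiso : Isoterm S (pw 0 m ++ pw 1 m))
    (h : Satisfies S u v) (hx : u.count x ≤ m) : v.count x = u.count x := by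
  have h1 := (h.restrict {x}).map (fun _ => 0)
  have e : ∀ w : Word, (restrict {x} w).map (fun _ => 0) = pw 0 (w.count x) := by
    intro w
    rw [restrict_eq_pw (x := x) (by simp) (by simp)]
    simp [pw]
  rw [e, e] at h1
  have h2 := Isoterm.pw_eq hm hiso hx (Nat.zero_le m) (w := pw 0 (v.count x)) (by simpa [pw] using h1)
  simpa [pw] using congrArg List.length h2

theorem Isoterm.restrict_eq (hm : 0 < m) (hiso : Isoterm S (pw 0 m ++ pw 1 m))
    (h : Satisfies S u v) (hxy : x ≠ y) (hp : Precedes x y u) (hx : u.count x ≤ m)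
    (hy : u.count y ≤ m) : restrict {x, y} u = restrict {x, y} v := by
  have h1 := (h.restrict {x, y}).map (fun z => if z = x then 0 else 1)
  have e : (restrict {x, y} u).map (fun z => if z = x then 0 else 1) =
      pw 0 (u.count x) ++ pw 1 (u.count y) := by
    rw [hp]
    simp [pw, hxy.symm]
  rw [e] at h1
  have h2 := Isoterm.pw_eq hm hiso hx hy h1
  rw [← e] at h2
  have h3 := congrArg (List.map fun z => if z = 0 then x else y) h2
  rw [List.map_map, List.map_map] at h3
  have h4 : ∀ w : Word, (restrict {x, y} w).map
      ((fun z => if z = 0 then x else y) ∘ fun z => if z = x then 0 else 1) = restrict {x, y} w := by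
    intro w
    conv_rhs => rw [← List.map_id (restrict {x, y} w)]
    apply List.map_congr_left
    intro z hz
    have := (mem_restrict.1 hz).2
    simp only [Finset.mem_insert, Finset.mem_singleton] at this
    rcases this with rfl | rfl
    · simp
    · simp [hxy.symm]
  rw [h4, h4] at h3
  exact h3.symm

theorem Isoterm.eq_nil (hm : 0 < m) (hiso : Isoterm S (pw 0 m ++ pw 1 m))
    (h : Satisfies S u []) : u = [] := by
  rw [List.eq_nil_iff_forall_not_mem]
  intro z
  have := Isoterm.count_eq hm hiso h.symm (x := z) (by simp)
  exact List.count_eq_zero.1 (by simpa using this)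

theorem Isoterm.lin_eq (hm : 0 < m) (hiso : Isoterm S (pw 0 m ++ pw 1 m))
    (h : Satisfies S u v) : lin u = lin v := by
  ext z
  rw [mem_lin, mem_lin]
  constructor
  · intro hz
    rw [Isoterm.count_eq hm hiso h (by omega), hz]
  · intro hz
    rw [Isoterm.count_eq hm hiso h.symm (by omega), hz]

theorem precedes_or_precedes_of_mem_lin (hxy : x ≠ y) (hx : x ∈ lin u) (hy : y ∈ lin u) :
    Precedes x y u ∨ Precedes y x u := by
  rw [mem_lin] at hx hy
  obtain ⟨P, Q, rfl⟩ := List.append_of_mem (List.count_pos_iff.1 (by omega : 0 < u.count x))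
  simp only [List.count_append, List.count_cons_self] at hx
  have hP : x ∉ P := List.count_eq_zero.1 (by omega)
  have hQ : x ∉ Q := List.count_eq_zero.1 (by omega)
  by_cases h : y ∈ P
  · right
    apply precedes_append hP
    have : 0 < P.count y := List.count_pos_iff.2 h
    rw [List.count_append] at hy
    rw [← List.count_eq_zero]
    omega
  · left
    have := precedes_append (P := P ++ [x]) (Q := Q) (x := x) (y := y) (by simp [h, hxy.symm]) hQ
    simpa using this

theorem Isoterm.restrict_singleton_eq (hm : 0 < m) (hiso : Isoterm S (pw 0 m ++ pw 1 m))
    (h : Satisfies S u v) (hx : u.count x ≤ m) : restrict {x, x} u = restrict {x, x} v := by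
  rw [restrict_eq_pw (x := x) (by simp) (by simp), restrict_eq_pw (x := x) (by simp) (by simp),
    Isoterm.count_eq hm hiso h hx]

/-- The linear variables occur in the same order on both sides of an identity of `S`. -/
theorem Isoterm.restrict_lin_eq (hm : 0 < m) (hiso : Isoterm S (pw 0 m ++ pw 1 m))
    (h : Satisfies S u v) {L : Finset ℕ} (hL : L ⊆ lin u) : restrict L u = restrict L v := by
  apply restrict_eq_of_pairs
  intro x hx y hy
  have key : ∀ z ∈ L, u.count z ≤ m := fun z hz => by
    have := mem_lin.1 (hL hz); omega
  rcases eq_or_ne x y with rfl | hxy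
  · exact Isoterm.restrict_singleton_eq hm hiso h (key x hx)
  · rcases precedes_or_precedes_of_mem_lin hxy (hL hx) (hL hy) with hp | hp
    · exact Isoterm.restrict_eq hm hiso h hxy hp (key x hx) (key y hy)
    · rw [Finset.pair_comm]
      exact Isoterm.restrict_eq hm hiso h hxy.symm hp (key y hy) (key x hx)

end IsotermConsequences

section WellQuasiOrder

theorem _root_.WellQuasiOrdered.exists_finite_subset_dominating {α : Type*} {r : α → α → Prop}
    (h : WellQuasiOrdered r) (T : Set α) :
    ∃ F : Set α, F.Finite ∧ F ⊆ T ∧ ∀ t ∈ T, ∃ f ∈ F, r f t := by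
  by_contra! hcon
  obtain ⟨f, hf, hf'⟩ := exists_seq_of_forall_finset_exists (· ∈ T) (fun a b => ¬ r a b) (by
    intro s hs
    obtain ⟨t, ht, ht'⟩ := hcon (s : Set α) s.finite_toSet (fun x hx => hs x hx)
    exact ⟨t, ht, fun x hx => ht' x hx⟩)
  obtain ⟨i, j, hij, hr⟩ := h f
  exact hf' i j hij hr

theorem wellQuasiOrdered_sublistForall₂_le :
    WellQuasiOrdered (List.SublistForall₂ ((· ≤ ·) : ℕ → ℕ → Prop)) := by
  rw [← Set.partiallyWellOrderedOn_univ_iff]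
  have := Set.PartiallyWellOrderedOn.partiallyWellOrderedOn_sublistForall₂ (· ≤ ·)
    (s := (Set.univ : Set ℕ)) (Set.partiallyWellOrderedOn_univ_iff.2 wellQuasiOrdered_le)
  simpa using this

instance : IsPreorder (List ℕ) (List.SublistForall₂ (· ≤ ·)) where

theorem of_sublistForall₂ {G : List ℕ → Prop} (hins : ∀ p s, G (p ++ s) → G (p ++ 0 :: s))
    (hinc : ∀ p a s, G (p ++ a :: s) → G (p ++ (a + 1) :: s)) {l l' : List ℕ}
    (h : List.SublistForall₂ (· ≤ ·) l l') (hl : G l) : G l' := by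
  have hle : ∀ p a b s, a ≤ b → G (p ++ a :: s) → G (p ++ b :: s) := by
    intro p a b s hab hG
    induction hab with
    | refl => exact hG
    | step _ ih => exact hinc _ _ _ ih
  suffices ∀ q, G (q ++ l) → G (q ++ l') from this [] hl
  clear hl
  induction h with
  | @nil l' =>
    induction l' with
    | nil => exact fun q h => h
    | cons a l' ih =>
      intro q hq
      have := hle q 0 a l' (Nat.zero_le _) (hins q l' (ih q hq))
      exact this
  | @cons a b l l' hab _ ih =>
    intro q hq
    have := ih (q ++ [b]) (by simpa using hle q a b l hab hq)
    simpa using this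
  | @cons_right b l l' _ ih =>
    intro q hq
    exact hle q 0 b l' (Nat.zero_le _) (hins q l' (ih q hq))

theorem lex_insert {p p' s s' : List ℕ} (hp : p'.length = p.length)
    (h : List.Lex (· < ·) (p' ++ s') (p ++ s)) :
    List.Lex (· < ·) (p' ++ 0 :: s') (p ++ 0 :: s) := by
  induction p generalizing p' with
  | nil =>
    obtain rfl := List.length_eq_zero_iff.1 hp
    exact .cons h
  | cons a p ih =>
    cases p' with
    | nil => simp at hp
    | cons a' p' =>
      cases h with
      | rel h => exact .rel h
      | cons h => exact .cons (ih (by simpa using hp) h)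

theorem lex_increment {p p' s s' : List ℕ} {a b : ℕ} (hp : p'.length = p.length)
    (h : List.Lex (· < ·) (p' ++ b :: s') (p ++ a :: s)) :
    List.Lex (· < ·) (p' ++ (b + 1) :: s') (p ++ (a + 1) :: s) := by
  induction p generalizing p' with
  | nil =>
    obtain rfl := List.length_eq_zero_iff.1 hp
    cases h with
    | rel h => exact .rel (Nat.succ_lt_succ h)
    | cons h => exact .cons h
  | cons a p ih =>
    cases p' with
    | nil => simp at hp
    | cons a' p' =>
      cases h with
      | rel h => exact .rel h
      | cons h => exact .cons (ih (by simpa using hp) h)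

end WellQuasiOrder

section Lace

/-- The word `x ^ a₁ w₁ x ^ a₂ w₂ ⋯ x ^ aₙ wₙ`. -/
def lace (x : ℕ) : List ℕ → List Word → Word
  | a :: l, w :: ws => pw x a ++ w ++ lace x l ws
  | _, _ => []

variable {x y : ℕ} {l p s : List ℕ} {ws wp : List Word}

@[simp] theorem lace_nil_left : lace x [] ws = [] := by
  cases ws <;> rfl

@[simp] theorem lace_nil_right : lace x l [] = [] := by
  cases l <;> rfl

@[simp] theorem lace_cons (a : ℕ) (w : Word) :
    lace x (a :: l) (w :: ws) = pw x a ++ w ++ lace x l ws := rfl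

theorem lace_append (h : p.length = wp.length) :
    lace x (p ++ s) (wp ++ ws) = lace x p wp ++ lace x s ws := by
  induction p generalizing wp with
  | nil =>
    obtain rfl := List.length_eq_zero_iff.1 h.symm
    simp
  | cons a p ih =>
    cases wp with
    | nil => simp at h
    | cons w wp => simp [ih (by simpa using h)]

theorem lace_flatMap (θ : ℕ → Word) (hx : θ x = [y]) :
    (lace x l ws).flatMap θ = lace y l (ws.map fun w => w.flatMap θ) := by
  induction l generalizing ws with
  | nil => simp
  | cons a l ih =>
    cases ws with
    | nil => simp
    | cons w ws =>
      have : (pw x a).flatMap θ = pw y a := by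
        induction a with
        | zero => simp [pw]
        | succ a ih => simp [pw, List.replicate_succ, hx] at ih ⊢; exact ih
      simp [ih, this]

theorem pw_flatMap (θ : ℕ → Word) (hx : θ x = [y]) (a : ℕ) : (pw x a).flatMap θ = pw y a := by
  have := lace_flatMap (l := [a]) (ws := [[]]) θ hx
  simpa using this

theorem exists_lace_append_eq (wp : List Word) (hwp : ∀ w ∈ wp, w ≠ []) (e : Word) :
    ∃ (C : Word) (wp' : List Word), wp'.length = wp.length ∧ (∀ w ∈ wp', w ≠ []) ∧
      ∀ x (r : List ℕ), r.length = wp.length → lace x r wp ++ e = C ++ lace x r wp' := by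
  rcases List.eq_nil_or_concat wp with rfl | ⟨wp0, w, rfl⟩
  · exact ⟨e, [], rfl, by simp, by simp⟩
  · refine ⟨[], wp0 ++ [w ++ e], by simp, ?_, ?_⟩
    · intro v hv
      simp only [List.mem_append, List.mem_singleton] at hv
      rcases hv with hv | rfl
      · exact hwp v (by simp [hv])
      · have := hwp w (by simp)
        simp [this]
    · intro x r hr
      rcases List.eq_nil_or_concat r with rfl | ⟨r0, a, rfl⟩
      · simp at hr
      · rw [List.concat_eq_append, List.concat_eq_append, lace_append (by simpa using hr),
          lace_append (by simpa using hr)]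
        simp

theorem map_flatMap_singletons (θ : ℕ → Word) (ts : List ℕ) (hts : ts.Nodup) (d : Word)
    (hlen : ts.length = ws.length) (hθ : ∀ t ∈ ts, θ t = ws.getD (ts.idxOf t) d) :
    (ts.map fun t => [t]).map (fun w => w.flatMap θ) = ws := by
  apply List.ext_getElem
  · simp [hlen]
  · intro i h1 h2
    simp only [List.length_map] at h1
    simp only [List.getElem_map, List.flatMap_cons, List.flatMap_nil, List.append_nil]
    rw [hθ _ (List.getElem_mem _), hts.idxOf_getElem]
    simp [h2]

theorem exists_eq_lace (x : ℕ) (h : Word) :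
    ∃ l c, l.length = (h.filter (· ≠ x)).length ∧
      h = lace x l ((h.filter (· ≠ x)).map fun t => [t]) ++ pw x c := by
  induction h with
  | nil => exact ⟨[], 0, rfl, by simp [pw]⟩
  | cons a h ih =>
    obtain ⟨l, c, hl, hh⟩ := ih
    by_cases ha : a = x
    · subst ha
      have e : (a :: h).filter (· ≠ a) = h.filter (· ≠ a) := by simp
      rw [e]
      generalize h.filter (· ≠ a) = ts at *
      cases l with
      | nil =>
        obtain rfl := List.length_eq_zero_iff.1 hl.symm
        refine ⟨[], c + 1, rfl, ?_⟩
        rw [hh]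
        simp [pw, List.replicate_succ]
      | cons b l =>
        cases ts with
        | nil => simp at hl
        | cons t ts =>
          refine ⟨(b + 1) :: l, c, by simpa using hl, ?_⟩
          rw [hh]
          simp [pw, List.replicate_succ]
    · have e : (a :: h).filter (· ≠ x) = a :: h.filter (· ≠ x) := by simp [ha]
      rw [e]
      refine ⟨0 :: l, c, by simpa using hl, ?_⟩
      simp only [List.map_cons, lace_cons]
      conv_lhs => rw [hh]
      simp [pw]

theorem count_lace_singletons_le {z : ℕ} (hz : z ≠ x) (ts : List ℕ) :
    (lace x l (ts.map fun t => [t])).count z ≤ ts.count z := by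
  induction ts generalizing l with
  | nil => simp
  | cons t ts ih =>
    cases l with
    | nil => simp
    | cons a l =>
      have : (pw x a).count z = 0 := by
        rw [List.count_eq_zero]
        exact fun h => hz (List.eq_of_mem_replicate h)
      simp only [List.map_cons, lace_cons, List.count_append, this, List.count_cons, List.count_nil]
      have := ih (l := l)
      omega

theorem almostLinear_of_count_le {u : Word} (h : ∀ z, z ≠ x → u.count z ≤ 1) : AlmostLinear u := by
  rw [AlmostLinear, Finset.card_le_one_iff_subset_singleton]
  refine ⟨x, fun z hz => ?_⟩
  rw [mem_nonlin] at hz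
  by_contra hzx
  have := h z (by simpa using hzx)
  omega

theorem AlmostLinear.exists_count_le {u : Word} (h : AlmostLinear u) :
    ∃ x, ∀ z, z ≠ x → u.count z ≤ 1 := by
  rw [AlmostLinear, Finset.card_le_one_iff_subset_singleton] at h
  obtain ⟨x, hx⟩ := h
  refine ⟨x, fun z hz => ?_⟩
  by_contra hc
  have := hx (mem_nonlin.2 (by omega : 1 < u.count z))
  exact hz (by simpa using this)

theorem nodup_filter_ne {x : ℕ} {u : Word} (h : ∀ z, z ≠ x → u.count z ≤ 1) :
    (u.filter (· ≠ x)).Nodup := by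
  rw [List.nodup_iff_count_le_one]
  intro z
  by_cases hz : z = x
  · rw [List.count_eq_zero.2 (by simp [hz])]; omega
  · exact (List.Sublist.count_le z List.filter_sublist).trans (h z hz)

theorem ne_nil_of_mem_map_singleton {ts : List ℕ} : ∀ w ∈ ts.map (fun t => [t]), w ≠ [] := by
  intro w hw
  obtain ⟨t, -, rfl⟩ := List.mem_map.1 hw
  simp

end Lace

section AlmostLinearBasis

variable {S : Type*} [Monoid S] {m : ℕ}

/-- `E` derives all substitution instances of the identity
`x ^ l₁ t₁ ⋯ x ^ lₙ tₙ x ^ c ≈ x ^ r₁ t₁ ⋯ x ^ rₙ tₙ x ^ c'`. -/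
def DerivesLaced (E : Set (Word × Word)) (l : List ℕ) (c : ℕ) (r : List ℕ) (c' : ℕ) : Prop :=
  ∀ x (ws : List Word), ws.length = l.length → (∀ w ∈ ws, w ≠ []) →
    Derives E (lace x l ws ++ pw x c) (lace x r ws ++ pw x c')

/-- The laced word with exponents `l, c` reduces to one with smaller exponents. -/
def LacedReducible (E : Set (Word × Word)) (l : List ℕ) (c : ℕ) : Prop :=
  ∃ r c', r.length = l.length ∧ List.Lex (· < ·) (r ++ [c']) (l ++ [c]) ∧ DerivesLaced E l c r c'

theorem exists_cons_of_length_eq {α β : Type*} {s : List β} {r : List α} {a : β}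
    (h : r.length = (a :: s).length) : ∃ b s', r = b :: s' ∧ s'.length = s.length := by
  cases r with
  | nil => simp at h
  | cons b s' => exact ⟨b, s', rfl, by simpa using h⟩

theorem exists_append_of_length_eq {α : Type*} {p s : List ℕ} {r : List α}
    (h : r.length = (p ++ s).length) :
    ∃ p' s' : List α, r = p' ++ s' ∧ p'.length = p.length ∧ s'.length = s.length := by
  refine ⟨r.take p.length, r.drop p.length, by simp, ?_, ?_⟩
  · simp only [List.length_append] at h; simp [h]
  · simp only [List.length_append] at h; simp [h]

variable {E : Set (Word × Word)}

theorem exists_lace_insert (x : ℕ) {p s : List ℕ} {ws : List Word}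
    (hws : ws.length = (p ++ 0 :: s).length) (hne : ∀ w ∈ ws, w ≠ []) :
    ∃ (C : Word) (ws' : List Word), ws'.length = (p ++ s).length ∧ (∀ w ∈ ws', w ≠ []) ∧
      ∀ q t : List ℕ, q.length = p.length →
        lace x (q ++ 0 :: t) ws = C ++ lace x (q ++ t) ws' := by
  obtain ⟨wp, ws, rfl, hwp, hws⟩ := exists_append_of_length_eq hws
  obtain ⟨w, ws, rfl, hws⟩ := exists_cons_of_length_eq hws
  obtain ⟨C, wp', hlen, hne', he⟩ := exists_lace_append_eq wp (fun v hv => hne v (by simp [hv])) w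
  refine ⟨C, wp' ++ ws, by simp; omega, ?_, ?_⟩
  · intro v hv
    rcases List.mem_append.1 hv with hv | hv
    · exact hne' v hv
    · exact hne v (by simp [hv])
  · intro q t hq
    rw [lace_append (by omega), lace_append (by omega), ← List.append_assoc, ← he x q (by omega)]
    simp [pw]

theorem exists_lace_increment (x : ℕ) {p s : List ℕ} {a : ℕ} {ws : List Word}
    (hws : ws.length = (p ++ (a + 1) :: s).length) (hne : ∀ w ∈ ws, w ≠ []) :
    ∃ (C : Word) (ws' : List Word), ws'.length = (p ++ a :: s).length ∧ (∀ w ∈ ws', w ≠ []) ∧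
      ∀ (q t : List ℕ) (e : ℕ), q.length = p.length →
        lace x (q ++ (e + 1) :: t) ws = C ++ lace x (q ++ e :: t) ws' := by
  obtain ⟨wp, ws, rfl, hwp, hws⟩ := exists_append_of_length_eq hws
  obtain ⟨C, wp', hlen, hne', he⟩ :=
    exists_lace_append_eq wp (fun v hv => hne v (by simp [hv])) [x]
  refine ⟨C, wp' ++ ws, by simp at hws ⊢; omega, ?_, ?_⟩
  · intro v hv
    rcases List.mem_append.1 hv with hv | hv
    · exact hne' v hv
    · exact hne v (by simp [hv])
  · intro q t e hq
    obtain ⟨w, ws, rfl, hws⟩ := exists_cons_of_length_eq hws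
    rw [lace_append (by omega), lace_append (by omega), ← List.append_assoc, ← he x q (by omega)]
    simp [pw, List.replicate_succ]

theorem LacedReducible.insert {p s : List ℕ} {c : ℕ} (h : LacedReducible E (p ++ s) c) :
    LacedReducible E (p ++ 0 :: s) c := by
  obtain ⟨r, c', hr, hlt, hd⟩ := h
  obtain ⟨p', s', rfl, hp', hs'⟩ := exists_append_of_length_eq hr
  refine ⟨p' ++ 0 :: s', c', by simp [hp', hs'], ?_, ?_⟩
  · simp only [List.append_assoc, List.cons_append] at hlt ⊢
    exact lex_insert hp' hlt
  · intro x ws hws hne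
    obtain ⟨C, ws', hlen, hne', he⟩ := exists_lace_insert x hws hne
    rw [he _ _ rfl, he _ _ hp']
    simpa using (hd x ws' hlen hne').context C []

theorem LacedReducible.increment {p s : List ℕ} {a c : ℕ} (h : LacedReducible E (p ++ a :: s) c) :
    LacedReducible E (p ++ (a + 1) :: s) c := by
  obtain ⟨r, c', hr, hlt, hd⟩ := h
  obtain ⟨p', s', rfl, hp', hs'⟩ := exists_append_of_length_eq hr
  obtain ⟨b, s', rfl, hs''⟩ := exists_cons_of_length_eq hs'
  refine ⟨p' ++ (b + 1) :: s', c', by simp [hp', hs''], ?_, ?_⟩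
  · simp only [List.append_assoc, List.cons_append] at hlt ⊢
    exact lex_increment hp' hlt
  · intro x ws hws hne
    obtain ⟨C, ws', hlen, hne', he⟩ := exists_lace_increment x hws hne
    rw [he _ _ _ rfl, he _ _ _ hp']
    simpa using (hd x ws' hlen hne').context C []

theorem LacedReducible.increment_last {l : List ℕ} {c c₁ : ℕ} (hc : c ≤ c₁)
    (h : LacedReducible E l c) : LacedReducible E l c₁ := by
  induction hc with
  | refl => exact h
  | step _ ih =>
    obtain ⟨r, c', hr, hlt, hd⟩ := ih
    refine ⟨r, c' + 1, hr, lex_increment hr hlt, ?_⟩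
    intro x ws hws hne
    have := (hd x ws hws hne).context [] [x]
    simpa [pw, List.replicate_succ'] using this

/-- The almost-linear identities of `S` follow from finitely many of them. -/
theorem exists_finite_almostLinear_basis (hm : 0 < m) (hiso : Isoterm S (pw 0 m ++ pw 1 m)) :
    ∃ E : Set (Word × Word), E.Finite ∧ E ⊆ equationalTheory S ∧
      (∀ p ∈ E, AlmostLinear p.1 ∧ AlmostLinear p.2) ∧
      ∀ h h', h ≠ [] → AlmostLinear h → Satisfies S h h' → Derives E h h' := by
  let T : Set (List ℕ × ℕ) := {q | ∃ (r : List ℕ) (c' x : ℕ) (ts : List ℕ),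
    r.length = q.1.length ∧ List.Lex (· < ·) (r ++ [c']) (q.1 ++ [q.2]) ∧
    ts.length = q.1.length ∧ ts.Nodup ∧ x ∉ ts ∧ lace x q.1 (ts.map fun t => [t]) ++ pw x q.2 ≠ [] ∧
    Satisfies S (lace x q.1 (ts.map fun t => [t]) ++ pw x q.2)
      (lace x r (ts.map fun t => [t]) ++ pw x c')}
  obtain ⟨F, hFfin, hFT, hF⟩ := (wellQuasiOrdered_sublistForall₂_le.prod
    (wellQuasiOrdered_le (α := ℕ))).exists_finite_subset_dominating T
  have hFT' : ∀ q : List ℕ × ℕ, q ∈ F → q ∈ T := fun q hq => hFT hq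
  choose! r c x ts hlen hlt htslen hnd hx hne hsat using hFT'
  let f : List ℕ × ℕ → Word × Word := fun q =>
    (lace (x q) q.1 ((ts q).map fun t => [t]) ++ pw (x q) q.2,
      lace (x q) (r q) ((ts q).map fun t => [t]) ++ pw (x q) (c q))
  have hsound : f '' F ⊆ equationalTheory S := by
    rintro _ ⟨q, hq, rfl⟩
    refine ⟨hne q hq, ?_, hsat q hq⟩
    intro h0
    have := hsat q hq
    have h1 : lace (x q) (r q) ((ts q).map fun t => [t]) ++ pw (x q) (c q) = [] := h0
    rw [h1] at this
    exact hne q hq (Isoterm.eq_nil hm hiso this)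
  have hAL : ∀ (l : List ℕ) (c x : ℕ) (ts : List ℕ), ts.Nodup →
      ∀ z, z ≠ x → (lace x l (ts.map fun t => [t]) ++ pw x c).count z ≤ 1 := by
    intro l c x ts hts z hz
    have h1 := count_lace_singletons_le (l := l) hz ts
    have h2 := List.nodup_iff_count_le_one.1 hts z
    have h3 : (pw x c).count z = 0 := by
      rw [List.count_eq_zero]
      exact fun h => hz (List.eq_of_mem_replicate h)
    rw [List.count_append]
    omega
  refine ⟨f '' F, hFfin.image f, hsound, ?_, ?_⟩
  · rintro _ ⟨q, hq, rfl⟩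
    exact ⟨almostLinear_of_count_le (hAL _ _ _ _ (hnd q hq)),
      almostLinear_of_count_le (hAL _ _ _ _ (hnd q hq))⟩
  have hFred : ∀ q ∈ F, LacedReducible (f '' F) q.1 q.2 := by
    intro q hq
    refine ⟨r q, c q, hlen q hq, hlt q hq, ?_⟩
    intro x' ws hws hwne
    have hmem : f q ∈ f '' F := ⟨q, hq, rfl⟩
    let θ : ℕ → Word := fun z => if z = x q then [x'] else ws.getD ((ts q).idxOf z) [x']
    have hθx : θ (x q) = [x'] := by simp [θ]
    have hθ : ∀ z, θ z ≠ [] := by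
      intro z
      by_cases hz : z = x q
      · simp [θ, hz]
      · simp only [θ, hz, if_false, List.getD_eq_getElem?_getD]
        rcases lt_or_ge ((ts q).idxOf z) ws.length with hi | hi
        · simpa [hi] using hwne _ (List.getElem_mem hi)
        · simp [List.getElem?_eq_none hi]
    have hmap := map_flatMap_singletons (ws := ws) θ (ts q) (hnd q hq) [x']
      (by rw [htslen q hq, hws]) (fun t ht => by
        have : t ≠ x q := fun h => hx q hq (h ▸ ht)
        simp only [θ, this, if_false])
    have := Derives.of_mem hmem θ hθ
    simp only [List.flatMap_append, lace_flatMap θ hθx, hmap, pw_flatMap θ hθx] at this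
    exact this
  have hTred : ∀ l c, (l, c) ∈ T → LacedReducible (f '' F) l c := by
    intro l c hT
    obtain ⟨⟨l0, c0⟩, hq, hle1, hle2⟩ := hF _ hT
    have h1 := of_sublistForall₂ (G := fun l => LacedReducible (f '' F) l c0)
      (fun _ _ h => h.insert) (fun _ _ _ h => h.increment) hle1 (hFred _ hq)
    exact h1.increment_last hle2
  have hnf : ∀ (x : ℕ) (ts : List ℕ) (w : List ℕ) (l : List ℕ) (c : ℕ), w = l ++ [c] →
      l.length = ts.length → ∃ n cn, n.length = ts.length ∧ (n, cn) ∉ T ∧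
      Derives (f '' F) (lace x l (ts.map fun t => [t]) ++ pw x c)
        (lace x n (ts.map fun t => [t]) ++ pw x cn) := by
    intro x ts w
    induction w using (List.Shortlex.wf (r := ((· < ·) : ℕ → ℕ → Prop)) wellFounded_lt).induction with
    | _ w ih =>
      rintro l c rfl hl
      by_cases hT : (l, c) ∈ T
      · obtain ⟨r, c', hr, hlt, hd⟩ := hTred l c hT
        obtain ⟨n, cn, hn, hnT, hd'⟩ := ih (r ++ [c'])
          (List.Shortlex.of_lex (by simp [hr]) hlt) r c' rfl (by omega)
        exact ⟨n, cn, hn, hnT, (hd x (ts.map fun t => [t]) (by simp [hl]) (by simp)).trans hd'⟩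
      · exact ⟨l, c, hl, hT, .refl _⟩
  intro h h' hh hal hsat'
  obtain ⟨x, hxle⟩ := hal.exists_count_le
  have hfil : h.filter (· ≠ x) = h'.filter (· ≠ x) := by
    have e : ∀ w : Word, (∀ z, z ≠ x → w.count z = h.count z) →
        w.filter (· ≠ x) = restrict (lin h \ {x}) w := by
      intro w hw
      apply List.filter_congr
      intro z hz
      by_cases hzx : z = x
      · simp [hzx]
      · have h1 := hxle z hzx
        have h2 := hw z hzx
        have h3 : 0 < w.count z := List.count_pos_iff.2 hz
        have : z ∈ lin h := mem_lin.2 (by omega)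
        simp [hzx, this]
    rw [e h (fun _ _ => rfl), e h' (fun z hz => Isoterm.count_eq hm hiso hsat' (by
      have := hxle z hz; omega))]
    exact Isoterm.restrict_lin_eq hm hiso hsat' Finset.sdiff_subset
  have hnd' := nodup_filter_ne hxle
  obtain ⟨l, c1, hl, e1⟩ := exists_eq_lace x h
  obtain ⟨l', c2, hl', e2⟩ := exists_eq_lace x h'
  rw [← hfil] at hl' e2
  have hxts : x ∉ h.filter (· ≠ x) := by simp
  generalize h.filter (· ≠ x) = us at *
  obtain ⟨n1, d1, hn1, hT1, hd1⟩ := hnf x us _ l c1 rfl hl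
  obtain ⟨n2, d2, hn2, hT2, hd2⟩ := hnf x us _ l' c2 rfl hl'
  rw [← e1] at hd1
  rw [← e2] at hd2
  have hs : Satisfies S (lace x n1 (us.map fun t => [t]) ++ pw x d1)
      (lace x n2 (us.map fun t => [t]) ++ pw x d2) :=
    (hd1.sound hsound).symm.trans (hsat'.trans (hd2.sound hsound))
  have hne1 : lace x n1 (us.map fun t => [t]) ++ pw x d1 ≠ [] := fun h0 =>
    hh (Isoterm.eq_nil hm hiso (h0 ▸ hd1.sound hsound))
  have hne2 : lace x n2 (us.map fun t => [t]) ++ pw x d2 ≠ [] := fun h0 =>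
    hne1 (Isoterm.eq_nil hm hiso (by rwa [h0] at hs))
  rcases trichotomous_of (List.Lex (· < ·)) (n1 ++ [d1]) (n2 ++ [d2]) with hlt' | heq | hlt'
  · exact absurd ⟨n1, d1, x, us, by simp; omega, hlt', hn2.symm, hnd', hxts, hne2, hs.symm⟩ hT2
  · have := List.append_inj' heq rfl
    obtain ⟨rfl, h2⟩ := this
    obtain rfl : d1 = d2 := by simpa using h2
    exact hd1.trans hd2.symm
  · exact absurd ⟨n2, d2, x, us, by simp; omega, hlt', hn1.symm, hnd', hxts, hne1, hs⟩ hT1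

end AlmostLinearBasis

section SwapIdentities

variable {S : Type*} [Monoid S] {m : ℕ} {E : Set (Word × Word)}

/-- `u x y v ≈ u y x v` is an identity of `S`, in which the occurrence of `x` is the last one and
that of `y` is the first one, and all variables other than `x`, `y` are linear. -/
structure IsSwap (S : Type*) [Monoid S] (x y : ℕ) (u v : Word) : Prop where
  ne : x ≠ y
  mem_left : x ∈ u
  notMem_left : y ∉ u
  notMem_right : x ∉ v
  mem_right : y ∈ v
  disjoint : ∀ z ∈ u, z ∉ v
  count_left : ∀ z, z ≠ x → u.count z ≤ 1
  count_right : ∀ z, z ≠ y → v.count z ≤ 1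
  sat : Satisfies S (u ++ [x, y] ++ v) (u ++ [y, x] ++ v)

theorem IsSwap.lt_count_left {x y : ℕ} {u v : Word} (h : IsSwap S x y u v) :
    1 < (u ++ [x, y] ++ v).count x := by
  have := List.count_pos_iff.2 h.mem_left
  simp only [List.count_append, List.count_cons_self]
  omega

theorem IsSwap.lt_count_right {x y : ℕ} {u v : Word} (h : IsSwap S x y u v) :
    1 < (u ++ [x, y] ++ v).count y := by
  have := List.count_pos_iff.2 h.mem_right
  simp only [List.count_append, List.count_cons, List.count_nil, beq_self_eq_true, if_true]
  omega

theorem nonlin_eq_of_perm {u v : Word} (h : u.Perm v) : nonlin u = nonlin v := by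
  ext z
  rw [mem_nonlin, mem_nonlin, h.count_eq]

theorem swap_perm (u v : Word) (x y : ℕ) : (u ++ [x, y] ++ v).Perm (u ++ [y, x] ++ v) :=
  ((List.Perm.swap y x []).append_left u).append_right v

theorem IsSwap.nonlin_eq {x y : ℕ} {u v : Word} (h : IsSwap S x y u v) :
    nonlin (u ++ [x, y] ++ v) = {x, y} := by
  ext z
  simp only [mem_nonlin, Finset.mem_insert, Finset.mem_singleton]
  constructor
  · intro hz
    by_contra! hne
    have h1 := h.count_left z hne.1
    have h2 := h.count_right z hne.2
    simp only [List.count_append, List.count_cons, List.count_nil, beq_iff_eq, hne.1.symm,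
      hne.2.symm, if_false] at hz
    by_cases hzu : z ∈ u
    · rw [List.count_eq_zero.2 (h.disjoint z hzu)] at hz
      omega
    · rw [List.count_eq_zero.2 hzu] at hz
      omega
  · rintro (rfl | rfl)
    · exact h.lt_count_left
    · exact h.lt_count_right

/-- `E` derives all substitution instances of the swap identity whose left part has exponents
`l, c` and whose right part, read backwards, has exponents `l', c'`. -/
def DerivesSwap (E : Set (Word × Word)) (l : List ℕ) (c : ℕ) (l' : List ℕ) (c' : ℕ) : Prop :=
  ∀ x y (ws ws' : List Word), ws.length = l.length → ws'.length = l'.length →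
    (∀ w ∈ ws, w ≠ []) → (∀ w ∈ ws', w ≠ []) →
    Derives E (lace x l ws ++ pw x c ++ [x, y] ++ (lace y l' ws' ++ pw y c').reverse)
      (lace x l ws ++ pw x c ++ [y, x] ++ (lace y l' ws' ++ pw y c').reverse)

theorem DerivesSwap.of_le {l₁ l₂ r₁ r₂ : List ℕ} {c₁ c₂ d₁ d₂ : ℕ} (h : DerivesSwap E l₁ c₁ r₁ d₁)
    (hl : List.SublistForall₂ (· ≤ ·) l₁ l₂) (hc : c₁ ≤ c₂)
    (hr : List.SublistForall₂ (· ≤ ·) r₁ r₂) (hd : d₁ ≤ d₂) : DerivesSwap E l₂ c₂ r₂ d₂ := by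
  have h1 : DerivesSwap E l₂ c₁ r₁ d₁ := by
    refine of_sublistForall₂ (G := fun l => DerivesSwap E l c₁ r₁ d₁) ?_ ?_ hl h
    · intro p s hd x y ws ws' hws hws' hne hne'
      obtain ⟨C, vs, hlen, hvs, he⟩ := exists_lace_insert x hws hne
      rw [he _ _ rfl]
      simpa using (hd x y vs ws' hlen hws' hvs hne').context C []
    · intro p a s hd x y ws ws' hws hws' hne hne'
      obtain ⟨C, vs, hlen, hvs, he⟩ := exists_lace_increment x hws hne
      rw [he _ _ _ rfl]
      simpa using (hd x y vs ws' hlen hws' hvs hne').context C []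
  have h2 : DerivesSwap E l₂ c₂ r₁ d₁ := by
    clear h
    induction hc with
    | refl => exact h1
    | step _ ih =>
      intro x y ws ws' hws hws' hne hne'
      obtain ⟨C, vs, hlen, hvs, he⟩ := exists_lace_append_eq ws hne [x]
      have := (ih x y vs ws' (hlen.trans hws) hws' hvs hne').context C []
      simp only [pw, List.replicate_succ] at this ⊢
      simp only [← List.append_assoc, List.append_nil] at this
      rw [← he x l₂ hws.symm] at this
      simpa using this
  have h3 : DerivesSwap E l₂ c₂ r₂ d₁ := by
    refine of_sublistForall₂ (G := fun r => DerivesSwap E l₂ c₂ r d₁) ?_ ?_ hr h2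
    · intro p s hd x y ws ws' hws hws' hne hne'
      obtain ⟨C, vs, hlen, hvs, he⟩ := exists_lace_insert y hws' hne'
      rw [he _ _ rfl]
      simpa using (hd x y ws vs hws hlen hne hvs).context [] C.reverse
    · intro p a s hd x y ws ws' hws hws' hne hne'
      obtain ⟨C, vs, hlen, hvs, he⟩ := exists_lace_increment y hws' hne'
      rw [he _ _ _ rfl]
      simpa using (hd x y ws vs hws hlen hne hvs).context [] C.reverse
  clear h h1 h2
  induction hd with
  | refl => exact h3
  | step _ ih =>
    intro x y ws ws' hws hws' hne hne'
    obtain ⟨C, vs, hlen, hvs, he⟩ := exists_lace_append_eq ws' hne' [y]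
    have := (ih x y ws vs hws (hlen.trans hws') hne hvs).context [] C.reverse
    have e : ∀ k, (lace y r₂ ws' ++ pw y (k + 1)).reverse =
        (lace y r₂ vs ++ pw y k).reverse ++ C.reverse := by
      intro k
      rw [← List.reverse_append, ← List.append_assoc, ← he y r₂ hws'.symm]
      simp [pw, List.replicate_succ]
    rw [e]
    simpa using this

theorem reverse_map_flatMap (θ : ℕ → Word) (u : Word) :
    u.reverse.flatMap θ = (u.flatMap fun z => (θ z).reverse).reverse := by
  induction u with
  | nil => simp
  | cons a u ih => simp [List.flatMap_append, ih]

/-- The swap identities of `S` follow from finitely many of them. -/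
theorem exists_finite_swap_basis (S : Type*) [Monoid S] :
    ∃ E : Set (Word × Word), E.Finite ∧ E ⊆ equationalTheory S ∧
      (∀ p ∈ E, BlockBalanced p.1 p.2 ∧ (nonlin p.1).card = 2 ∧ (nonlin p.2).card = 2) ∧
      ∀ x y u v, IsSwap S x y u v →
        Derives E (u ++ [x, y] ++ v) (u ++ [y, x] ++ v) := by
  let P : (List ℕ × ℕ) × (List ℕ × ℕ) → ℕ → ℕ → Word → Word → Prop := fun q x y u v =>
    IsSwap S x y u v ∧ q.1.1.length = (u.filter (· ≠ x)).length ∧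
      u = lace x q.1.1 ((u.filter (· ≠ x)).map fun t => [t]) ++ pw x q.1.2 ∧
      q.2.1.length = (v.reverse.filter (· ≠ y)).length ∧
      v.reverse = lace y q.2.1 ((v.reverse.filter (· ≠ y)).map fun t => [t]) ++ pw y q.2.2
  let T : Set ((List ℕ × ℕ) × (List ℕ × ℕ)) := {q | ∃ x y u v, P q x y u v}
  have hwqo := wellQuasiOrdered_sublistForall₂_le.prod (wellQuasiOrdered_le (α := ℕ))
  have : IsPreorder (List ℕ × ℕ) fun a b : List ℕ × ℕ =>
      List.SublistForall₂ (· ≤ ·) a.1 b.1 ∧ a.2 ≤ b.2 :=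
    { refl := fun a => ⟨refl_of _ a.1, le_refl _⟩
      trans := fun a b c h h' => ⟨trans_of _ h.1 h'.1, h.2.trans h'.2⟩ }
  obtain ⟨F, hFfin, hFT, hF⟩ := (hwqo.prod hwqo).exists_finite_subset_dominating T
  have hFT' : ∀ q, q ∈ F → q ∈ T := fun q hq => hFT hq
  choose! x y u v hP using hFT'
  let f : (List ℕ × ℕ) × (List ℕ × ℕ) → Word × Word := fun q =>
    (u q ++ [x q, y q] ++ v q, u q ++ [y q, x q] ++ v q)
  have hFder : ∀ q ∈ F, DerivesSwap (f '' F) q.1.1 q.1.2 q.2.1 q.2.2 := by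
    intro q hq x' y' ws ws' hws hws' hne hne'
    have hmem : f q ∈ f '' F := ⟨q, hq, rfl⟩
    obtain ⟨hsw, hl1, hu, hl2, hv⟩ := hP q hq
    have hnd1 := nodup_filter_ne hsw.count_left
    have hnd2 := nodup_filter_ne (x := y q) (u := (v q).reverse)
      (by simpa using hsw.count_right)
    have hy1 : y q ∉ (u q).filter (· ≠ x q) := fun h => hsw.notMem_left (List.mem_filter.1 h).1
    have hx2 : x q ∉ (v q).reverse.filter (· ≠ y q) := fun h =>
      hsw.notMem_right (List.mem_reverse.1 (List.mem_filter.1 h).1)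
    have hdisj : ∀ z ∈ (v q).reverse.filter (· ≠ y q), z ∉ (u q).filter (· ≠ x q) := fun z h h' =>
      hsw.disjoint z (List.mem_filter.1 h').1 (List.mem_reverse.1 (List.mem_filter.1 h).1)
    have hx1 : x q ∉ (u q).filter (· ≠ x q) := by simp
    have hy2 : y q ∉ (v q).reverse.filter (· ≠ y q) := by simp
    set ts := (u q).filter (· ≠ x q)
    set ts' := (v q).reverse.filter (· ≠ y q)
    let θ : ℕ → Word := fun z => if z = x q then [x'] else if z = y q then [y'] else
      if z ∈ ts then ws.getD (ts.idxOf z) [x'] else (ws'.getD (ts'.idxOf z) [x']).reverse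
    have hgetD : ∀ (vs : List Word) i, (∀ w ∈ vs, w ≠ []) → vs.getD i [x'] ≠ [] := by
      intro vs i hvs
      rw [List.getD_eq_getElem?_getD]
      rcases lt_or_ge i vs.length with hi | hi
      · simpa [hi] using hvs _ (List.getElem_mem hi)
      · simp [List.getElem?_eq_none hi]
    have hθ : ∀ z, θ z ≠ [] := by
      intro z
      simp only [θ]
      split_ifs
      · simp
      · simp
      · exact hgetD _ _ hne
      · simpa using hgetD _ _ hne'
    have hθx : θ (x q) = [x'] := by simp [θ]
    have hθy : θ (y q) = [y'] := by simp [θ, hsw.ne.symm]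
    have hmap := map_flatMap_singletons (ws := ws) θ ts hnd1 [x'] (by rw [← hl1, hws])
      (fun t ht => by
        have h1 : t ≠ x q := fun h => hx1 (h ▸ ht)
        have h2 : t ≠ y q := fun h => hy1 (h ▸ ht)
        simp only [θ, h1, h2, ht, if_true, if_false])
    have hmap' := map_flatMap_singletons (ws := ws') (fun z => (θ z).reverse) ts' hnd2 [x']
      (by rw [← hl2, hws']) (fun t ht => by
        have h1 : t ≠ x q := fun h => hx2 (h ▸ ht)
        have h2 : t ≠ y q := fun h => hy2 (h ▸ ht)
        simp only [θ, h1, h2, hdisj t ht, if_false, List.reverse_reverse])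
    have eu : (u q).flatMap θ = lace x' q.1.1 ws ++ pw x' q.1.2 := by
      rw [hu, List.flatMap_append, lace_flatMap θ hθx, hmap, pw_flatMap θ hθx]
    have ev : (v q).flatMap θ = (lace y' q.2.1 ws' ++ pw y' q.2.2).reverse := by
      rw [← List.reverse_reverse (v q), hv, reverse_map_flatMap, List.flatMap_append,
        lace_flatMap (y := y') _ (by simp [hθy]), hmap', pw_flatMap (y := y') _ (by simp [hθy])]
    have := Derives.of_mem hmem θ hθ
    simpa [List.flatMap_append, eu, ev, hθx, hθy] using this
  refine ⟨f '' F, hFfin.image f, ?_, ?_, ?_⟩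
  · rintro _ ⟨q, hq, rfl⟩
    exact ⟨by simp [f], by simp [f], (hP q hq).1.sat⟩
  · rintro _ ⟨q, hq, rfl⟩
    have hsw := (hP q hq).1
    refine ⟨blockBalanced_swap _ _ hsw.lt_count_left.ne' hsw.lt_count_right.ne', ?_, ?_⟩
    · simp only [f]
      rw [hsw.nonlin_eq, Finset.card_pair hsw.ne]
    · simp only [f]
      rw [← nonlin_eq_of_perm (swap_perm _ _ _ _), hsw.nonlin_eq, Finset.card_pair hsw.ne]
  · intro x y u v hsw
    obtain ⟨l, c, hl, hu⟩ := exists_eq_lace x u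
    obtain ⟨l', c', hl', hv⟩ := exists_eq_lace y v.reverse
    obtain ⟨q, hq, ⟨hle1, hle2⟩, hle3, hle4⟩ :=
      hF ((l, c), (l', c')) ⟨x, y, u, v, hsw, hl, hu, hl', hv⟩
    have := (hFder q hq).of_le hle1 hle2 hle3 hle4 x y ((u.filter (· ≠ x)).map fun t => [t])
      ((v.reverse.filter (· ≠ y)).map fun t => [t]) (by simp [hl]) (by simp [hl'])
      ne_nil_of_mem_map_singleton ne_nil_of_mem_map_singleton
    rwa [← hu, ← hv, List.reverse_reverse] at this

/-- Swap identities may be applied under substitutions that delete linear variables. -/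
theorem IsSwap.derives {x y : ℕ} {u v : Word}
    (hE : ∀ x y u v, IsSwap S x y u v → Derives E (u ++ [x, y] ++ v) (u ++ [y, x] ++ v))
    (h : IsSwap S x y u v) {θ₁ θ₂ : ℕ → Word} {a b : ℕ} (h₁ : θ₁ x = [a]) (h₂ : θ₂ y = [b])
    (C D : Word) :
    Derives E (C ++ u.flatMap θ₁ ++ [a, b] ++ v.flatMap θ₂ ++ D)
      (C ++ u.flatMap θ₁ ++ [b, a] ++ v.flatMap θ₂ ++ D) := by
  let θ : ℕ → Word := fun z => if z = x then [a] else if z = y then [b] else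
    if z ∈ u then θ₁ z else θ₂ z
  have eu : u.flatMap θ₁ = u.flatMap θ := by
    apply List.flatMap_congr
    intro z hz
    have : z ≠ y := fun h' => h.notMem_left (h' ▸ hz)
    by_cases hzx : z = x
    · simp [θ, hzx, h₁]
    · simp [θ, hzx, this, hz]
  have ev : v.flatMap θ₂ = v.flatMap θ := by
    apply List.flatMap_congr
    intro z hz
    have h3 : z ≠ x := fun h' => h.notMem_right (h' ▸ hz)
    have h4 : z ∉ u := fun h' => h.disjoint z h' hz
    by_cases hzy : z = y
    · simp [θ, hzy, h₂, h.ne.symm]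
    · simp [θ, hzy, h3, h4]
  let η : ℕ → Word := fun z => if θ z = [] then [x] else θ z
  have hη : ∀ z, η z ≠ [] := by
    intro z
    simp only [η]
    split_ifs with hz
    · simp
    · exact hz
  let X : Finset ℕ := (u ++ [x, y] ++ v).toFinset.filter fun z => θ z ≠ []
  have hθx : θ x = [a] := by simp [θ]
  have hθy : θ y = [b] := by simp [θ, h.ne.symm]
  have hxX : x ∈ X := by simp [X, hθx]
  have hyX : y ∈ X := by simp [X, hθy]
  have hres : ∀ w : Word, (∀ z ∈ w, z ∈ u ++ [x, y] ++ v) →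
      w.flatMap θ = (restrict X w).flatMap η := by
    intro w hw
    induction w with
    | nil => simp
    | cons c w ih =>
      have ih := ih fun z hz => hw z (by simp [hz])
      have hc := hw c (by simp)
      by_cases hcX : θ c = []
      · rw [restrict_cons_of_not_mem (by simp [X, hcX])]
        simp [hcX, ih]
      · rw [restrict_cons_of_mem (by simp only [X, Finset.mem_filter, List.mem_toFinset]
                                     exact ⟨hc, hcX⟩)]
        simp [η, hcX, ih]
  have hsw : IsSwap S x y (restrict X u) (restrict X v) := by
    refine ⟨h.ne, mem_restrict.2 ⟨h.mem_left, hxX⟩, fun h' => h.notMem_left (mem_restrict.1 h').1,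
      fun h' => h.notMem_right (mem_restrict.1 h').1, mem_restrict.2 ⟨h.mem_right, hyX⟩,
      fun z hz hz' => h.disjoint z (mem_restrict.1 hz).1 (mem_restrict.1 hz').1,
      fun z hz => (List.Sublist.count_le z List.filter_sublist).trans (h.count_left z hz),
      fun z hz => (List.Sublist.count_le z List.filter_sublist).trans (h.count_right z hz), ?_⟩
    have := h.sat.restrict X
    simpa [restrict_cons_of_mem hxX, restrict_cons_of_mem hyX] using this
  have := ((hE x y _ _ hsw).flatMap η hη).context C D
  have hηx : η x = [a] := by simp [η, hθx]
  have hηy : η y = [b] := by simp [η, hθy]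
  rw [eu, ev, hres u (by intro z hz; simp [hz]), hres v (by intro z hz; simp [hz])]
  simpa [List.flatMap_append, hηx, hηy] using this

end SwapIdentities

section Gathering

variable {E : Set (Word × Word)} {L : Finset ℕ} {x y z : ℕ} {P Q B : Word}

/-- Adjacent occurrences of two variables commute modulo `E` if both are non-last or both are
non-first. -/
structure Commutes (E : Set (Word × Word)) : Prop where
  of_mem_right : ∀ {P Q : Word} {x z : ℕ}, x ∈ Q → z ∈ Q →
    Derives E (P ++ [x, z] ++ Q) (P ++ [z, x] ++ Q)
  of_mem_left : ∀ {P Q : Word} {x z : ℕ}, x ∈ P → z ∈ P →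
    Derives E (P ++ [x, z] ++ Q) (P ++ [z, x] ++ Q)

theorem Commutes.pw_move (hE : Commutes E) (hP : x ∈ P) (hQ : x ∈ Q) (hz : z ∈ P ∨ z ∈ Q) (e : ℕ) :
    Derives E (P ++ [z] ++ pw x e ++ Q) (P ++ pw x e ++ [z] ++ Q) := by
  induction e generalizing P with
  | zero => simpa [pw] using Derives.refl _
  | succ e ih =>
    have h1 : Derives E (P ++ [z, x] ++ (pw x e ++ Q)) (P ++ [x, z] ++ (pw x e ++ Q)) := by
      rcases hz with hz | hz
      · exact hE.of_mem_left hz hP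
      · exact hE.of_mem_right (by simp [hz]) (by simp [hQ])
    have h2 := ih (P := P ++ [x]) (by simp) (by
      rcases hz with hz | hz
      · simp [hz]
      · simp [hz])
    have h3 := h1.trans (by simpa using h2)
    simpa [pw, List.replicate_succ] using h3

theorem mem_append_or_of_lt_count {A D : Word} (h : 1 < (A ++ [z] ++ D).count z) :
    z ∈ A ∨ z ∈ D := by
  by_contra! hn
  rw [List.count_append, List.count_append, List.count_eq_zero.2 hn.1,
    List.count_eq_zero.2 hn.2] at h
  simp at h

/-- Occurrences of `x` that are neither first nor last move to the left end of a factor. -/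
theorem Commutes.push_left (hE : Commutes E) (hP : x ∈ P) (hQ : x ∈ Q)
    (hB : ∀ z ∈ B, 1 < (P ++ B ++ Q).count z) :
    Derives E (P ++ B ++ Q) (P ++ pw x (B.count x) ++ B.filter (· ≠ x) ++ Q) := by
  induction B generalizing P with
  | nil => simpa [pw] using Derives.refl _
  | cons b B ih =>
    have h1 := ih (P := P ++ [b]) (by simp [hP]) (by
      intro z hz
      simpa using hB z (by simp [hz]))
    have h1' : Derives E (P ++ b :: B ++ Q)
        (P ++ [b] ++ pw x (B.count x) ++ B.filter (· ≠ x) ++ Q) := by simpa using h1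
    refine h1'.trans ?_
    by_cases hb : b = x
    · subst hb
      simpa [pw, List.replicate_succ] using Derives.refl _
    · have h2 := hE.pw_move (P := P) (Q := B.filter (· ≠ x) ++ Q) (z := b) hP (by simp [hQ]) (by
        have h3 := mem_append_or_of_lt_count (A := P) (D := B ++ Q) (z := b)
          (by simpa using hB b (by simp))
        rcases h3 with h3 | h3
        · exact .inl h3
        · right
          rcases List.mem_append.1 h3 with h3 | h3
          · simp [h3, hb]
          · simp [h3]) (B.count x)
      simpa [hb, List.count_cons] using h2

theorem count_filter_ne_self (B : Word) : (B.filter (· ≠ x)).count x = 0 := by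
  rw [List.count_eq_zero]; simp

theorem count_pw_self (e : ℕ) : (pw x e).count x = e := by simp [pw]

theorem filter_pw_self (e : ℕ) : (pw x e).filter (· ≠ x) = [] := by simp [pw]

theorem count_pw_of_ne (h : z ≠ x) (e : ℕ) : (pw x e).count z = 0 := by
  rw [List.count_eq_zero]
  exact fun h' => h (List.eq_of_mem_replicate h')

theorem count_filter_of_ne (h : z ≠ x) (B : Word) : (B.filter (· ≠ x)).count z = B.count z := by
  rw [List.count_filter]; simpa using h

theorem pw_filter_perm (x : ℕ) (B : Word) {i j : ℕ} (hij : i + j = B.count x) :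
    B.Perm (pw x i ++ B.filter (· ≠ x) ++ pw x j) := by
  rw [List.perm_iff_count]
  intro z
  simp only [List.count_append]
  by_cases hz : z = x
  · subst hz
    rw [count_pw_self, count_pw_self, count_filter_ne_self]; omega
  · rw [count_pw_of_ne hz, count_pw_of_ne hz, count_filter_of_ne hz]; omega

theorem Commutes.push_both (hE : Commutes E) (hP : x ∈ P) (hQ : x ∈ Q)
    (hB : ∀ z ∈ B, 1 < (P ++ B ++ Q).count z) {i j : ℕ} (hij : i + j = B.count x) :
    Derives E (P ++ B ++ Q) (P ++ (pw x i ++ B.filter (· ≠ x) ++ pw x j) ++ Q) := by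
  have hperm := pw_filter_perm x B hij
  refine (hE.push_left hP hQ hB).trans ?_
  have h2 := hE.push_left (B := pw x i ++ B.filter (· ≠ x) ++ pw x j) hP hQ (by
    intro z hz
    have := hB z (hperm.mem_iff.2 hz)
    rwa [((hperm.append_left P).append_right Q).count_eq] at this)
  rw [← hperm.count_eq] at h2
  simp only [List.filter_append, filter_pw_self, List.filter_filter, List.nil_append,
    List.append_nil, Bool.and_self] at h2
  exact h2.symm

/-- Reading `w` from the left, an occurrence of `x` is met before any variable in `L`. -/
def Reach (x : ℕ) (L : Finset ℕ) : Word → Prop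
  | [] => False
  | a :: w => a = x ∨ (a ∉ L ∧ Reach x L w)

/-- Within each block of `w`, where blocks are separated by the variables in `L`, all occurrences
of `x` are adjacent. -/
def Gathered (x : ℕ) (L : Finset ℕ) : Word → Prop
  | [] => True
  | a :: w => Gathered x L w ∧ (a = x → Reach x L w → w.head? = some x)

theorem Reach.mem {w : Word} (h : Reach x L w) : x ∈ w := by
  induction w with
  | nil => exact h.elim
  | cons a w ih =>
    rcases h with rfl | ⟨-, h⟩
    · simp
    · simp [ih h]

theorem Gathered.append_of_notMem {N w : Word} (hN : x ∉ N) (hw : Gathered x L w) :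
    Gathered x L (N ++ w) := by
  induction N with
  | nil => exact hw
  | cons a N ih =>
    simp only [List.mem_cons, not_or] at hN
    exact ⟨ih hN.2, fun h => absurd h.symm hN.1⟩

theorem gathered_of_notMem {w : Word} (hw : x ∉ w) : Gathered x L w := by
  simpa using Gathered.append_of_notMem (L := L) hw (w := []) trivial

theorem Gathered.pw_append {w : Word} (hw : Gathered x L w) (h : Reach x L w → w.head? = some x)
    (e : ℕ) : Gathered x L (pw x e ++ w) := by
  induction e with
  | zero => simpa [pw] using hw
  | succ e ih =>
    have : pw x (e + 1) ++ w = x :: (pw x e ++ w) := by simp [pw, List.replicate_succ]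
    rw [this]
    refine ⟨ih, fun _ hr => ?_⟩
    cases e with
    | zero => exact h (by simpa [pw] using hr)
    | succ e => simp [pw, List.replicate_succ]

theorem reach_append_iff {C w : Word} (hC : restrict (insert x L) C = []) :
    Reach x L (C ++ w) ↔ Reach x L w := by
  rw [restrict_eq_nil_iff] at hC
  induction C with
  | nil => simp
  | cons a C ih =>
    have ha := hC a (by simp)
    simp only [Finset.mem_insert, not_or] at ha
    rw [List.cons_append, Reach, ih fun z hz => hC z (by simp [hz])]
    simp [ha.1, ha.2]

theorem Commutes.exists_push (hE : Commutes E) (hx : x ∉ L) {t : ℕ} (ht : t ∈ L) (K : Word) :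
    ∃ (e : ℕ) (K₀ : Word),
      (pw x e ++ K₀).filter (· ≠ x) = (K ++ [t]).filter (· ≠ x) ∧
      restrict (insert x L) (pw x e ++ K₀) = restrict (insert x L) (K ++ [t]) ∧
      (∀ R, Gathered x L R → Gathered x L (K₀ ++ R) ∧ ¬ Reach x L (K₀ ++ R)) ∧
      ∀ P Q, x ∈ P → x ∈ Q → (∀ z ∈ K, z ∉ L → 1 < (P ++ (K ++ [t]) ++ Q).count z) →
        Derives E (P ++ (K ++ [t]) ++ Q) (P ++ (pw x e ++ K₀) ++ Q) := by
  have htx : t ≠ x := fun h => hx (h ▸ ht)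
  induction K with
  | nil =>
    refine ⟨0, [t], by simp [pw], by simp [pw], ?_, ?_⟩
    · intro R hR
      exact ⟨⟨hR, fun h => absurd h htx⟩, by simp [Reach, htx, ht]⟩
    · intro P Q _ _ _
      simpa [pw] using Derives.refl _
  | cons a K ih =>
    obtain ⟨e, K₀, h1, h2, h3, h4⟩ := ih
    have h4' : ∀ P Q, x ∈ P → x ∈ Q → (∀ z ∈ a :: K, z ∉ L → 1 < (P ++ (a :: K ++ [t]) ++ Q).count z) →
        Derives E (P ++ (a :: K ++ [t]) ++ Q) (P ++ [a] ++ (pw x e ++ K₀) ++ Q) := by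
      intro P Q hP hQ hz
      have := h4 (P ++ [a]) Q (by simp [hP]) hQ (fun z hz' hzL => by
        simpa using hz z (by simp [hz']) hzL)
      simpa using this
    by_cases hax : a = x
    · subst hax
      refine ⟨e + 1, K₀, ?_, ?_, h3, ?_⟩
      · simpa [pw, List.replicate_succ] using h1
      · have : pw a (e + 1) ++ K₀ = a :: (pw a e ++ K₀) := by simp [pw, List.replicate_succ]
        rw [this, List.cons_append, restrict_cons_of_mem (by simp), restrict_cons_of_mem (by simp),
          h2]
      · intro P Q hP hQ hz
        simpa [pw, List.replicate_succ] using h4' P Q hP hQ hz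
    by_cases haL : a ∈ L
    · refine ⟨0, a :: (pw x e ++ K₀), ?_, ?_, ?_, ?_⟩
      · simp only [pw, List.replicate_zero, List.nil_append, List.cons_append]
        rw [List.filter_cons, List.filter_cons, h1]
      · simp only [pw, List.replicate_zero, List.nil_append, List.cons_append]
        rw [restrict_cons_of_mem (by simp [haL]), restrict_cons_of_mem (by simp [haL]), h2]
      · intro R hR
        obtain ⟨h5, h6⟩ := h3 R hR
        refine ⟨⟨?_, fun h => absurd h hax⟩, by simp [Reach, hax, haL]⟩
        have := h5.pw_append (fun h => absurd h h6) e
        simpa using this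
      · intro P Q hP hQ hz
        simpa [pw] using h4' P Q hP hQ hz
    · have haK : a ∉ insert x L := by simp [hax, haL]
      refine ⟨e, a :: K₀, ?_, ?_, ?_, ?_⟩
      · simp only [List.filter_append, filter_pw_self, List.nil_append] at h1 ⊢
        simpa [hax] using h1
      · simp only [restrict_append, List.cons_append, restrict_cons_of_not_mem haK] at h2 ⊢
        exact h2
      · intro R hR
        obtain ⟨h5, h6⟩ := h3 R hR
        exact ⟨⟨h5, fun h => absurd h hax⟩, by simp [Reach, hax, haL, h6]⟩
      · intro P Q hP hQ hz
        refine (h4' P Q hP hQ hz).trans ?_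
        have h5 := mem_append_or_of_lt_count (A := P) (D := K ++ [t] ++ Q) (z := a)
          (by simpa using hz a (by simp) haL)
        have h6 := hE.pw_move (P := P) (Q := K₀ ++ Q) (x := x) (z := a) hP (by simp [hQ]) (by
          rcases h5 with h5 | h5
          · exact .inl h5
          · right
            rcases List.mem_append.1 h5 with h5 | h5
            · have h7 : a ∈ (K ++ [t]).filter (· ≠ x) := List.mem_filter.2 ⟨h5, by simp [hax]⟩
              rw [← h1] at h7
              simp only [List.filter_append, filter_pw_self, List.nil_append] at h7
              simp [(List.mem_filter.1 h7).1]
            · simp [h5]) e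
        simpa using h6

theorem exists_last_mem {M : Word} (h : ∃ z ∈ M, z ∈ L) :
    ∃ K t N, M = K ++ [t] ++ N ∧ t ∈ L ∧ ∀ z ∈ N, z ∉ L := by
  induction M using List.reverseRecOn with
  | nil => simp at h
  | append_singleton M a ih =>
    by_cases ha : a ∈ L
    · exact ⟨M, a, [], by simp, ha, by simp⟩
    · obtain ⟨K, t, N, rfl, ht, hN⟩ := ih (by
        obtain ⟨z, hz, hzL⟩ := h
        rcases List.mem_append.1 hz with hz | hz
        · exact ⟨z, hz, hzL⟩
        · obtain rfl : z = a := by simpa using hz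
          exact absurd hzL ha)
      refine ⟨K, t, N ++ [a], by simp, ht, ?_⟩
      intro z hz
      rcases List.mem_append.1 hz with hz | hz
      · exact hN z hz
      · obtain rfl : z = a := by simpa using hz
        exact ha

/-- If the first and last occurrences of `x` are in different blocks, then `x` can be gathered. -/
theorem Commutes.exists_gather (hE : Commutes E) (hx : x ∉ L) {M : Word} (hM : ∃ z ∈ M, z ∈ L) :
    ∃ M₀ : Word, M₀.filter (· ≠ x) = M.filter (· ≠ x) ∧
      restrict (insert x L) M₀ = restrict (insert x L) M ∧
      (∀ p q, x ∉ p → x ∉ q → Gathered x L (p ++ [x] ++ M₀ ++ [x] ++ q)) ∧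
      ∀ P Q, x ∈ P → x ∈ Q → (∀ z ∈ M, z ∉ L → 1 < (P ++ M ++ Q).count z) →
        Derives E (P ++ M ++ Q) (P ++ M₀ ++ Q) := by
  obtain ⟨K, t, N, rfl, ht, hN⟩ := exists_last_mem hM
  obtain ⟨e, K₀, h1, h2, h3, h4⟩ := hE.exists_push hx ht K
  have hfil : (N.filter (· ≠ x) ++ pw x (N.count x)).filter (· ≠ x) = N.filter (· ≠ x) := by
    rw [List.filter_append, filter_pw_self, List.append_nil, List.filter_filter]; simp
  have hresN : ∀ N : Word, (∀ z ∈ N, z ∉ L) → restrict (insert x L) N = pw x (N.count x) :=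
    fun N hN => restrict_eq_pw (fun z hz hz' => by
      rcases Finset.mem_insert.1 hz' with h | h
      · exact h
      · exact absurd h (hN z hz)) (by simp)
  refine ⟨pw x e ++ K₀ ++ (N.filter (· ≠ x) ++ pw x (N.count x)), ?_, ?_, ?_, ?_⟩
  · rw [List.filter_append, h1, hfil, List.filter_append (_ ++ _)]
  · have hN' := hresN (N.filter (· ≠ x) ++ pw x (N.count x)) (by
      intro z hz
      rcases List.mem_append.1 hz with hz | hz
      · exact hN z (List.mem_filter.1 hz).1
      · rw [List.eq_of_mem_replicate hz]; exact hx)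
    rw [List.count_append, count_filter_ne_self, count_pw_self, Nat.zero_add] at hN'
    rw [restrict_append, h2, restrict_append (v := N), hresN N hN, hN']
  · intro p q hp hq
    have hq1 : Gathered x L (x :: q) :=
      ⟨gathered_of_notMem hq, fun _ h => absurd h.mem hq⟩
    have h5 := hq1.pw_append (fun _ => rfl) (N.count x)
    have h6 := Gathered.append_of_notMem (N := N.filter (· ≠ x)) (by simp) h5
    obtain ⟨h7, h8⟩ := h3 _ h6
    have h9 := (h7.pw_append (fun h => absurd h h8) (e + 1)).append_of_notMem hp
    simpa [pw, List.replicate_succ] using h9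
  · intro P Q hP hQ hz
    have h5 := h4 P (N ++ Q) hP (by simp [hQ]) (fun z hz' hzL => by
      simpa using hz z (by simp [hz']) hzL)
    have hperm : (pw x e ++ K₀).Perm (K ++ [t]) := by
      rw [List.perm_iff_count]
      intro z
      by_cases hzx : z = x
      · subst hzx
        have := congrArg (List.count z) h2
        rwa [count_restrict_of_mem (by simp), count_restrict_of_mem (by simp)] at this
      · rw [← count_filter_of_ne hzx, h1, count_filter_of_ne hzx]
    have h6 := hE.push_both (P := P ++ (pw x e ++ K₀)) (Q := Q) (B := N) (x := x) (by simp [hP]) hQ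
      (by
        intro z hz'
        have := hz z (by simp [hz']) (hN z hz')
        rw [(((hperm.append_left P).append_right N).append_right Q).count_eq]
        simpa using this) (i := 0) (j := N.count x) (by simp)
    have h5' : Derives E (P ++ (K ++ [t] ++ N) ++ Q) (P ++ (pw x e ++ K₀) ++ N ++ Q) := by
      simpa using h5
    refine h5'.trans ?_
    simpa [pw] using h6

/-- A word in which `x` is gathered is a substitution instance of its restriction to `x` and `L`. -/
theorem Gathered.exists_eq_flatMap (hx : x ∉ L) {w : Word} (hw : Gathered x L w)
    (hL : ∀ t ∈ L, w.count t ≤ 1) :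
    ∃ (C D : Word) (θ : ℕ → Word), w = C ++ (restrict (insert x L) w).flatMap θ ++ D ∧
      restrict (insert x L) C = [] ∧ restrict (insert x L) D = [] ∧ θ x = [x] ∧
      (∀ z, θ z ≠ []) ∧ ∀ z, restrict (insert x L) (θ z) = restrict (insert x L) [z] := by
  induction w with
  | nil => exact ⟨[], [], fun z => [z], by simp, by simp, by simp, by simp, by simp, by simp⟩
  | cons a w ih =>
    obtain ⟨C, D, θ, h1, h2, h3, h4, h5, h6⟩ := ih hw.1 (fun t ht => by
      have := hL t ht
      rw [List.count_cons] at this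
      omega)
    have hupd : ∀ (t : ℕ) (v h : Word), t ∉ h → h.flatMap (Function.update θ t v) = h.flatMap θ := by
      intro t v h ht
      apply List.flatMap_congr
      intro z hz
      rw [Function.update_of_ne]
      rintro rfl
      exact ht hz
    by_cases hax : a = x
    · subst hax
      rw [restrict_cons_of_mem (by simp)]
      by_cases hC : C = []
      · subst hC
        refine ⟨[], D, θ, ?_, by simp, h3, h4, h5, h6⟩
        conv_lhs => rw [h1]
        simp [h4]
      · have hRes : Reach a L w → w.head? = some a := hw.2 rfl
        rcases hh : restrict (insert a L) w with _ | ⟨b, h⟩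
        · refine ⟨[], C ++ D, θ, ?_, by simp, by simp [h2, h3], h4, h5, h6⟩
          conv_lhs => rw [h1]
          simp [hh, h4]
        · rw [hh] at h1
          by_cases hba : b = a
          · exfalso
            subst hba
            have h7 : Reach b L w := by
              rw [h1, List.append_assoc, reach_append_iff h2]
              simp [h4, Reach]
            have h8 := hRes h7
            obtain ⟨c, C', rfl⟩ := List.exists_cons_of_ne_nil hC
            rw [h1] at h8
            obtain rfl : c = b := by simpa using h8
            rw [restrict_cons_of_mem (by simp)] at h2
            simp at h2
          · have hbm : b ∈ restrict (insert a L) w := by rw [hh]; simp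
            have hbL : b ∈ L := by
              rcases Finset.mem_insert.1 (mem_restrict.1 hbm).2 with h | h
              · exact absurd h hba
              · exact h
            have hbh : b ∉ h := by
              intro hb
              have h7 := hL b hbL
              have h8 : (restrict (insert a L) w).count b = w.count b :=
                count_restrict_of_mem (by simp [hbL])
              rw [hh, List.count_cons_self] at h8
              have := List.count_pos_iff.2 hb
              rw [List.count_cons] at h7
              omega
            refine ⟨[], D, Function.update θ b (C ++ θ b), ?_, by simp, h3, ?_, ?_, ?_⟩
            · conv_lhs => rw [h1]
              simp only [List.flatMap_cons, hupd b _ h hbh, Function.update_self]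
              rw [Function.update_of_ne (Ne.symm hba), h4]
              simp
            · rw [Function.update_of_ne (Ne.symm hba), h4]
            · intro z
              by_cases hz : z = b
              · subst hz; simp [hC]
              · rw [Function.update_of_ne hz]; exact h5 z
            · intro z
              by_cases hz : z = b
              · subst hz
                rw [Function.update_self, restrict_append, h2, List.nil_append, h6]
              · rw [Function.update_of_ne hz]; exact h6 z
    by_cases haL : a ∈ L
    · have hah : a ∉ restrict (insert x L) w := by
        intro ha
        have h7 := hL a haL
        have := List.count_pos_iff.2 (mem_restrict.1 ha).1
        rw [List.count_cons_self] at h7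
        omega
      rw [restrict_cons_of_mem (by simp [haL])]
      refine ⟨[], D, Function.update θ a ([a] ++ C), ?_, by simp, h3, ?_, ?_, ?_⟩
      · conv_lhs => rw [h1]
        simp only [List.flatMap_cons, hupd a _ _ hah, Function.update_self]
        simp
      · rw [Function.update_of_ne (Ne.symm hax), h4]
      · intro z
        by_cases hz : z = a
        · subst hz; simp
        · rw [Function.update_of_ne hz]; exact h5 z
      · intro z
        by_cases hz : z = a
        · subst hz
          rw [Function.update_self, restrict_append, h2, List.append_nil]
        · rw [Function.update_of_ne hz]; exact h6 z
    · have haK : a ∉ insert x L := by simp [hax, haL]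
      rw [restrict_cons_of_not_mem haK]
      refine ⟨a :: C, D, θ, ?_, ?_, h3, h4, h5, h6⟩
      · conv_lhs => rw [h1]
        simp
      · rw [restrict_cons_of_not_mem haK, h2]

end Gathering

section Balancing

variable {S : Type*} [Monoid S] {m : ℕ} {E : Set (Word × Word)}

/-- A set `E` of identities of `S` that contains enough almost-linear identities and identities
with two non-linear variables, for a monoid `S` as in the main theorem. -/
structure IsRichBasis (S : Type*) [Monoid S] (m : ℕ) (E : Set (Word × Word)) : Prop where
  pos : 0 < m
  iso : Isoterm S (pw 0 m ++ pw 1 m)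
  sound : E ⊆ equationalTheory S
  comm : Commutes E
  swap : ∀ x y u v, IsSwap S x y u v → Derives E (u ++ [x, y] ++ v) (u ++ [y, x] ++ v)
  almostLinear : ∀ h h', h ≠ [] → AlmostLinear h → Satisfies S h h' → Derives E h h'
  exists_swap : ∃ d, 0 < d ∧ d ≤ m ∧
    Satisfies S (pw 0 (m + 1 - d) ++ [2] ++ pw 0 d ++ [1, 3, 1])
      (pw 0 (m + 1 - d) ++ [2] ++ pw 0 (d - 1) ++ [1, 0, 3, 1])
  condI : ∀ k, 1 < k → k ≤ m → CondI S k
  condII : ∀ k, 1 < k → k ≤ m → CondII S k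

variable {x y z : ℕ} {p q u v w M P Q : Word}

theorem pw_add (x i j : ℕ) : pw x (i + j) = pw x i ++ pw x j := by
  simp [pw, List.replicate_append_replicate]

theorem pw_succ' (x i : ℕ) : pw x (i + 1) = pw x i ++ [x] := by
  simp [pw, List.replicate_succ']

theorem pw_succ (x i : ℕ) : pw x (i + 1) = x :: pw x i := by
  simp [pw, List.replicate_succ]

theorem mem_pw_iff {i : ℕ} : z ∈ pw x i ↔ i ≠ 0 ∧ z = x := by simp [pw]

/-- The last occurrence of `x` passes the first occurrence of `y` if `x` occurs often enough. -/
theorem IsRichBasis.last_first (hE : IsRichBasis S m E) (hy : y ∈ Q) (hcount : m ≤ M.count x + 1)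
    (hM : ∀ z ∈ M, 1 < (p ++ [x] ++ M ++ [x, y] ++ Q).count z) :
    Derives E (p ++ [x] ++ M ++ [x, y] ++ Q) (p ++ [x] ++ M ++ [y, x] ++ Q) := by
  obtain ⟨d, hd, hdm, hsat⟩ := hE.exists_swap
  have hsw : IsSwap S 0 1 (pw 0 (m + 1 - d) ++ [2] ++ pw 0 (d - 1)) [3, 1] := by
    refine ⟨by simp, ?_, ?_, by simp, by simp, ?_, ?_, ?_, ?_⟩
    · simp only [List.mem_append, mem_pw_iff]
      left; left; exact ⟨by omega, trivial⟩
    · simp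
    · intro z hz
      simp only [List.mem_append, mem_pw_iff, List.mem_singleton] at hz
      rcases hz with (⟨-, rfl⟩ | rfl) | ⟨-, rfl⟩ <;> simp
    · intro z hz
      rw [List.count_append, List.count_append, count_pw_of_ne hz, count_pw_of_ne hz]
      simp [List.count_cons]
      split <;> simp
    · intro z hz
      simp [List.count_cons, Ne.symm hz]
      split <;> simp
    · have e : pw 0 d = pw 0 (d - 1) ++ [0] := by rw [← pw_succ']; congr 1; omega
      rw [e] at hsat
      simpa using hsat
  obtain ⟨q₁, q₂, rfl⟩ := List.append_of_mem hy
  have hij : (M.count x - (d - 1)) + (d - 1) = M.count x := by omega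
  have h1 := hE.comm.push_both (P := p ++ [x]) (Q := [x, y] ++ (q₁ ++ y :: q₂)) (B := M) (x := x)
    (by simp) (by simp) (by simpa using hM) hij
  have h2 := hE.comm.push_both (P := p ++ [x]) (Q := [y, x] ++ (q₁ ++ y :: q₂)) (B := M) (x := x)
    (by simp) (by simp) (by
      intro z hz
      have := hM z hz
      rw [(swap_perm _ _ _ _).count_eq] at this
      simpa using this) hij
  have h3 := hsw.derives hE.swap (a := x) (b := y)
    (θ₁ := fun z => if z = 0 then [x] else pw x (M.count x - (d - 1) - (m - d)) ++
      M.filter (· ≠ x))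
    (θ₂ := fun z => if z = 1 then [y] else q₁) rfl rfl p q₂
  have e1 : (pw 0 (m + 1 - d) ++ [2] ++ pw 0 (d - 1)).flatMap (fun z => if z = 0 then [x] else
      pw x (M.count x - (d - 1) - (m - d)) ++ M.filter (· ≠ x)) =
      [x] ++ pw x (M.count x - (d - 1)) ++ M.filter (· ≠ x) ++ pw x (d - 1) := by
    rw [List.flatMap_append, List.flatMap_append, pw_flatMap _ rfl, pw_flatMap _ rfl]
    have : m + 1 - d + (M.count x - (d - 1) - (m - d)) = M.count x - (d - 1) + 1 := by omega
    have e2 := pw_add x (m + 1 - d) (M.count x - (d - 1) - (m - d))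
    rw [this, pw_succ] at e2
    simp only [List.flatMap_cons, List.flatMap_nil, List.append_nil]
    simp only [OfNat.ofNat_ne_zero, if_false]
    simp only [← List.append_assoc, ← e2]
    simp
  rw [e1] at h3
  refine Derives.trans (by simpa using h1) (Derives.trans ?_ (Derives.symm (by simpa using h2)))
  simpa using h3

/-- If `x` occurs often enough, all its occurrences in a block can be gathered. -/
theorem IsRichBasis.gather (hE : IsRichBasis S m E) (hcount : m ≤ M.count x + 1)
    (hM : ∀ z ∈ M, 1 < (p ++ [x] ++ M ++ [x] ++ q).count z) :
    Derives E (p ++ [x] ++ M ++ [x] ++ q)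
      (p ++ pw x (M.count x + 2) ++ M.filter (· ≠ x) ++ q) := by
  have h1 := hE.comm.push_left (P := p ++ [x]) (Q := [x] ++ q) (B := M) (x := x) (by simp) (by simp)
    (by simpa using hM)
  have hkey : ∀ N q', x ∉ N →
      (∀ z ∈ N, 1 < (p ++ [x] ++ (pw x (M.count x) ++ N) ++ [x] ++ q').count z) →
      Derives E (p ++ [x] ++ (pw x (M.count x) ++ N) ++ [x] ++ q')
        (p ++ [x] ++ pw x (M.count x) ++ [x] ++ N ++ q') := by
    intro N
    induction N using List.reverseRecOn with
    | nil => intro q' _ _; simpa using Derives.refl _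
    | append_singleton N z ih =>
      intro q' hx hN
      have hzx : x ≠ z := fun h => hx (by simp [h])
      have hxN : x ∉ N := fun h => hx (by simp [h])
      have h2 : Derives E (p ++ [x] ++ (pw x (M.count x) ++ N) ++ [z, x] ++ q')
          (p ++ [x] ++ (pw x (M.count x) ++ N) ++ [x, z] ++ q') := by
        by_cases hz : z ∈ p ++ [x] ++ (pw x (M.count x) ++ N)
        · exact hE.comm.of_mem_left hz (by simp)
        · have hzq : z ∈ q' := by
            have := mem_append_or_of_lt_count (A := p ++ [x] ++ (pw x (M.count x) ++ N))
              (D := [x] ++ q') (z := z) (by simpa using hN z (by simp))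
            rcases this with h | h
            · exact absurd h hz
            · simpa [hzx.symm] using h
          refine (hE.last_first hzq ?_ ?_).symm
          · rw [List.count_append, count_pw_self]; omega
          · intro a ha
            rcases List.mem_append.1 ha with ha | ha
            · rw [(mem_pw_iff.1 ha).2]
              simp only [List.count_append, List.count_cons_self, List.count_nil]
              omega
            · have := hN a (by simp [ha])
              rw [← (swap_perm _ _ _ _).count_eq]
              simpa using this
      have h3 := ih (z :: q') hxN (by
        intro a ha
        have := hN a (by simp [ha])
        rw [show p ++ [x] ++ (pw x (M.count x) ++ N) ++ [x] ++ z :: q' =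
          p ++ [x] ++ (pw x (M.count x) ++ N) ++ [x, z] ++ q' by simp,
          ← (swap_perm _ _ _ _).count_eq]
        simpa using this)
      refine Derives.trans (by simpa using h2) (Derives.trans (by simpa using h3) ?_)
      simpa using Derives.refl _
  have hperm : (p ++ [x] ++ M ++ [x] ++ q).Perm
      (p ++ [x] ++ (pw x (M.count x) ++ M.filter (· ≠ x)) ++ [x] ++ q) := by
    have := pw_filter_perm x M (i := M.count x) (j := 0) (by simp)
    simp only [pw, List.replicate_zero, List.append_nil] at this
    exact ((this.append_left _).append_right _).append_right _
  have h4 := hkey (M.filter (· ≠ x)) q (by simp) (fun z hz => by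
    rw [← hperm.count_eq]
    exact hM z (List.mem_filter.1 hz).1)
  refine Derives.trans (by simpa using h1) (Derives.trans (by simpa using h4) ?_)
  rw [show M.count x + 2 = (M.count x + 1) + 1 from rfl, pw_succ, pw_succ']
  simpa using Derives.refl _

theorem exists_eq_append_first (h : x ∈ w) : ∃ p q, w = p ++ [x] ++ q ∧ x ∉ p := by
  obtain ⟨p, q, rfl, hp⟩ := List.eq_append_cons_of_mem h
  exact ⟨p, q, by simp, hp⟩

theorem exists_eq_append_last (h : x ∈ w) : ∃ p q, w = p ++ [x] ++ q ∧ x ∉ q := by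
  obtain ⟨p, q, hpq, hp⟩ := exists_eq_append_first (List.mem_reverse.2 h)
  refine ⟨q.reverse, p.reverse, ?_, by simpa using hp⟩
  have := congrArg List.reverse hpq
  simpa using this

theorem exists_eq_append_first_last (h : 1 < w.count x) :
    ∃ p M q, w = p ++ [x] ++ M ++ [x] ++ q ∧ x ∉ p ∧ x ∉ q := by
  obtain ⟨p, w', rfl, hp⟩ := exists_eq_append_first (List.count_pos_iff.1 (by omega : 0 < w.count x))
  rw [List.count_append, List.count_append, List.count_eq_zero.2 hp] at h
  obtain ⟨M, q, rfl, hq⟩ := exists_eq_append_last (x := x) (w := w')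
    (List.count_pos_iff.1 (by simp at h; exact List.count_pos_iff.2 h))
  exact ⟨p, M, q, by simp, hp, hq⟩

theorem one_lt_count_of_notMem_lin (hz : z ∈ w) (h : z ∉ lin w) : 1 < w.count z := by
  have := List.count_pos_iff.2 hz
  rw [mem_lin] at h
  omega

theorem restrict_eq_pw_of_disjoint {L : Finset ℕ} (h : ∀ z ∈ w, z ∉ L) :
    restrict (insert x L) w = pw x (w.count x) :=
  restrict_eq_pw (fun z hz hz' => (Finset.mem_insert.1 hz').resolve_right (h z hz)) (by simp)

theorem filter_ne_eq_of_count {L : Finset ℕ} (hx : x ∉ L) (w : Word) :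
    (restrict (insert x L) w).filter (· ≠ x) = restrict L w := by
  rw [restrict, List.filter_filter]
  apply List.filter_congr
  intro z _
  by_cases hz : z = x
  · subst hz; simp [hx]
  · simp [hz]

theorem restrict_filter_ne {L : Finset ℕ} (hx : x ∉ L) (w : Word) :
    restrict L (w.filter (· ≠ x)) = restrict L w := by
  rw [restrict, List.filter_filter]
  apply List.filter_congr
  intro z _
  by_cases hz : z = x
  · subst hz; simp [hx]
  · simp [hz]

theorem perm_of_filter_eq {L : Finset ℕ} (h1 : u.filter (· ≠ x) = w.filter (· ≠ x))
    (h2 : restrict (insert x L) u = restrict (insert x L) w) : u.Perm w := by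
  rw [List.perm_iff_count]
  intro z
  by_cases hz : z = x
  · subst hz
    have := congrArg (List.count z) h2
    rwa [count_restrict_of_mem (by simp), count_restrict_of_mem (by simp)] at this
  · rw [← count_filter_of_ne hz, h1, count_filter_of_ne hz]

/-- A non-linear variable either can be gathered, or it occurs at most `m` times, all of them in
one block. -/
theorem IsRichBasis.exists_gathered (hE : IsRichBasis S m E) (hx : 1 < w.count x) :
    (∃ w₀, Derives E w w₀ ∧ w₀.filter (· ≠ x) = w.filter (· ≠ x) ∧
      restrict (insert x (lin w)) w₀ = restrict (insert x (lin w)) w ∧ Gathered x (lin w) w₀) ∨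
    (w.count x ≤ m ∧ ∀ t ∈ lin w, Precedes x t w ∨ Precedes t x w) := by
  obtain ⟨p, M, q, hw, hp, hq⟩ := exists_eq_append_first_last hx
  have hxL : x ∉ lin w := by rw [mem_lin]; omega
  have hMnl : ∀ z ∈ M, z ∉ lin w → 1 < w.count z := fun z hz hzL =>
    one_lt_count_of_notMem_lin (by rw [hw]; simp [hz]) hzL
  by_cases hM : ∃ z ∈ M, z ∈ lin w
  · left
    obtain ⟨M₀, h1, h2, h3, h4⟩ := hE.comm.exists_gather hxL hM
    refine ⟨p ++ [x] ++ M₀ ++ [x] ++ q, ?_, ?_, ?_, h3 p q hp hq⟩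
    · have := h4 (p ++ [x]) ([x] ++ q) (by simp) (by simp) (fun z hz hzL => by
        have := hMnl z hz hzL
        rw [hw] at this
        simpa using this)
      conv => arg 2; rw [hw]
      simpa using this
    · conv_rhs => rw [hw]
      simp only [List.filter_append, h1]
    · generalize lin w = L at *
      rw [hw]
      simp only [restrict_append, h2]
  push Not at hM
  by_cases hc : m ≤ M.count x + 1
  · left
    refine ⟨p ++ pw x (M.count x + 2) ++ M.filter (· ≠ x) ++ q, ?_, ?_, ?_, ?_⟩
    · conv => arg 2; rw [hw]
      exact hE.gather hc (fun z hz => by rw [← hw]; exact hMnl z hz (hM z hz))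
    · conv_rhs => rw [hw]
      simp [List.filter_filter]
    · generalize lin w = L at *
      rw [hw]
      have e1 : restrict (insert x L) (pw x (M.count x + 2)) = pw x (M.count x + 2) :=
        restrict_eq_self (fun z hz => by simp [(mem_pw_iff.1 hz).2])
      have e2 : restrict (insert x L) (M.filter (· ≠ x)) = [] := by
        rw [restrict_eq_nil_iff]
        intro z hz
        obtain ⟨h1, h2⟩ := List.mem_filter.1 hz
        simp only [ne_eq, decide_not, Bool.not_eq_eq_eq_not, Bool.not_true,
          decide_eq_false_iff_not] at h2
        simp [h2, hM z h1]
      have e3 : restrict (insert x L) [x] = [x] := restrict_cons_of_mem (by simp)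
      simp only [restrict_append, e1, e2, e3, restrict_eq_pw_of_disjoint hM]
      rw [show M.count x + 2 = (M.count x + 1) + 1 from rfl, pw_succ, pw_succ']
      simp
    · have h1 : x ∉ M.filter (· ≠ x) ++ q := by simp [hq]
      have h2 := (gathered_of_notMem (L := lin w) h1).pw_append (fun h => absurd h.mem h1)
        (M.count x + 2)
      have := h2.append_of_notMem hp
      simpa using this
  · right
    constructor
    · rw [hw]
      simp only [List.count_append, List.count_eq_zero.2 hp, List.count_eq_zero.2 hq,
        List.count_cons_self, List.count_nil]
      omega
    · intro t ht
      have htx : t ≠ x := fun h => hxL (h ▸ ht)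
      have htM : t ∉ M := fun h => hM t h ht
      by_cases htp : t ∈ p
      · right
        have : t ∉ [x] ++ M ++ [x] ++ q := by
          have h1 := mem_lin.1 ht
          have h2 := List.count_pos_iff.2 htp
          rw [hw] at h1
          simp only [List.append_assoc] at h1 ⊢
          rw [List.count_append] at h1
          exact List.count_eq_zero.1 (by omega)
        have := precedes_append (x := t) (y := x) hp this
        rw [hw]
        simpa using this
      · left
        have := precedes_append (P := p ++ [x] ++ M ++ [x]) (Q := q) (x := x) (y := t)
          (by simp [htp, htx, htM]) hq
        rwa [← hw] at this

theorem filter_flatMap_eq {L : Finset ℕ} {θ : ℕ → Word} (hθx : θ x = [x])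
    (hθ : ∀ z, restrict (insert x L) (θ z) = restrict (insert x L) [z]) (h : Word) :
    (h.flatMap θ).filter (· ≠ x) = (h.filter (· ≠ x)).flatMap θ := by
  induction h with
  | nil => simp
  | cons a h ih =>
    rw [List.flatMap_cons, List.filter_append, ih]
    by_cases ha : a = x
    · subst ha; simp [hθx]
    · have : x ∉ θ a := by
        intro hxa
        have h1 : x ∈ restrict (insert x L) (θ a) := mem_restrict.2 ⟨hxa, by simp⟩
        rw [hθ] at h1
        have h2 := (mem_restrict.1 h1).1
        simp at h2
        exact ha h2.symm
      rw [List.filter_eq_self.2 (by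
        intro z hz
        have : z ≠ x := fun h => this (h ▸ hz)
        simp [this])]
      simp [ha]

theorem restrict_flatMap_eq {L : Finset ℕ} {θ : ℕ → Word}
    (hθ : ∀ z, restrict L (θ z) = restrict L [z]) (h : Word) :
    restrict L (h.flatMap θ) = restrict L h := by
  induction h with
  | nil => simp
  | cons a h ih =>
    rw [List.flatMap_cons, restrict_append, ih, hθ, ← restrict_append]
    simp

theorem IsRichBasis.exists_balance_one (hE : IsRichBasis S m E) (h : Satisfies S w v)
    (hx : 1 < w.count x) :
    ∃ w', Derives E w w' ∧ w'.filter (· ≠ x) = w.filter (· ≠ x) ∧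
      restrict (insert x (lin w)) w' = restrict (insert x (lin w)) v := by
  have hxL : x ∉ lin w := by rw [mem_lin]; omega
  rcases hE.exists_gathered hx with ⟨w₀, h1, h2, h3, h4⟩ | ⟨hc, hp⟩
  · have hperm := perm_of_filter_eq h2 h3
    obtain ⟨C, D, θ, e, hC, hD, hθx, hne, hθ⟩ := h4.exists_eq_flatMap hxL (fun t ht => by
      rw [hperm.count_eq, mem_lin.1 ht])
    rw [h3] at e
    have hmem : x ∈ restrict (insert x (lin w)) w :=
      mem_restrict.2 ⟨List.count_pos_iff.1 (by omega), by simp⟩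
    have hd := hE.almostLinear (restrict (insert x (lin w)) w) (restrict (insert x (lin w)) v)
      (List.ne_nil_of_mem hmem) (almostLinear_of_count_le (x := x) (by
        intro z hz
        by_cases hzL : z ∈ lin w
        · rw [count_restrict_of_mem (by simp [hzL]), mem_lin.1 hzL]
        · rw [count_restrict_of_not_mem (by simp [hz, hzL])]
          omega)) (h.restrict _)
    refine ⟨C ++ (restrict (insert x (lin w)) v).flatMap θ ++ D,
      h1.trans (e ▸ (hd.flatMap θ hne).context C D), ?_, ?_⟩
    · rw [← h2, e]
      simp only [List.filter_append, filter_flatMap_eq hθx hθ, filter_ne_eq_of_count hxL]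
      rw [Isoterm.restrict_lin_eq hE.pos hE.iso h (Finset.Subset.refl _)]
    · rw [restrict_append, restrict_append, hC, hD, restrict_flatMap_eq hθ, restrict_restrict,
        Finset.inter_self]
      simp
  · refine ⟨w, .refl _, rfl, restrict_eq_of_pairs ?_⟩
    have hL : ∀ t ∈ lin w, w.count t ≤ m := fun t ht => by
      have := mem_lin.1 ht
      have := hE.pos
      omega
    have hxt : ∀ t ∈ lin w, restrict {x, t} w = restrict {x, t} v := by
      intro t ht
      have htx : x ≠ t := fun h => hxL (h ▸ ht)
      rcases hp t ht with hp | hp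
      · exact Isoterm.restrict_eq hE.pos hE.iso h htx hp hc (hL t ht)
      · rw [Finset.pair_comm]
        exact Isoterm.restrict_eq hE.pos hE.iso h htx.symm hp (hL t ht) hc
    intro a ha b hb
    rcases Finset.mem_insert.1 ha with ha' | ha'
    · rcases Finset.mem_insert.1 hb with hb' | hb'
      · rw [ha', hb']
        exact Isoterm.restrict_singleton_eq hE.pos hE.iso h hc
      · rw [ha']
        exact hxt b hb'
    · rcases Finset.mem_insert.1 hb with hb' | hb'
      · rw [hb', Finset.pair_comm]
        exact hxt a ha'
      · exact Isoterm.restrict_lin_eq hE.pos hE.iso h (by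
          simp [Finset.insert_subset_iff, ha', hb'])

/-- Modulo the almost-linear identities of `S`, every identity of `S` is block-balanced. -/
theorem IsRichBasis.exists_blockBalanced (hE : IsRichBasis S m E) (h : Satisfies S w v) :
    ∃ w', Derives E w w' ∧ BlockBalanced w' v := by
  have hm := hE.pos
  have hind : ∀ X : Finset ℕ, X ⊆ nonlin w → ∃ w', Derives E w w' ∧
      ∀ x ∈ X, restrict (insert x (lin w)) w' = restrict (insert x (lin w)) v := by
    intro X
    induction X using Finset.induction_on with
    | empty => exact fun _ => ⟨w, .refl _, by simp⟩
    | insert x X hxX ih =>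
      intro hX
      obtain ⟨w₁, hw₁, h1⟩ := ih (fun z hz => hX (by simp [hz]))
      have hs := hw₁.sound hE.sound
      have hlin := Isoterm.lin_eq hm hE.iso hs
      have hxw := mem_nonlin.1 (hX (Finset.mem_insert_self x X))
      have hx₁ : 1 < w₁.count x := by
        by_contra hc
        have := Isoterm.count_eq hm hE.iso hs.symm (x := x) (by omega)
        omega
      obtain ⟨w₂, hw₂, h2, h3⟩ := hE.exists_balance_one (hs.symm.trans h) hx₁
      rw [← hlin] at h3
      refine ⟨w₂, hw₁.trans hw₂, ?_⟩
      intro z hz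
      rcases Finset.mem_insert.1 hz with rfl | hz
      · exact h3
      · have hxz : x ∉ insert z (lin w) := by
          rw [Finset.mem_insert, mem_lin]
          rintro (rfl | h)
          · exact hxX hz
          · omega
        rw [← restrict_filter_ne hxz, h2, restrict_filter_ne hxz, h1 z hz]
  obtain ⟨w', hw', h1⟩ := hind _ (Finset.Subset.refl _)
  refine ⟨w', hw', ?_⟩
  intro z
  have hs := hw'.sound hE.sound
  rw [← Isoterm.lin_eq hm hE.iso hs]
  by_cases hz : z ∈ nonlin w
  · exact h1 z hz
  have hlin : restrict (lin w) w' = restrict (lin w) v := by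
    rw [← Isoterm.restrict_lin_eq hm hE.iso hs (Finset.Subset.refl _),
      ← Isoterm.restrict_lin_eq hm hE.iso h (Finset.Subset.refl _)]
  by_cases hzL : z ∈ lin w
  · rwa [Finset.insert_eq_of_mem hzL]
  · have hz0 : w.count z = 0 := by
      rw [mem_nonlin] at hz
      rw [mem_lin] at hzL
      omega
    have hkey : ∀ g : Word, Satisfies S w g → restrict (insert z (lin w)) g = restrict (lin w) g := by
      intro g hg
      apply restrict_congr
      intro a ha
      have : a ≠ z := by
        rintro rfl
        have h2 := Isoterm.count_eq hm hE.iso hg (x := a) (by omega)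
        have := List.count_pos_iff.2 ha
        omega
      simp [this]
    rw [hkey _ hs, hkey _ h, hlin]

end Balancing

section Sorting

variable {E : Set (Word × Word)} {x y z a b : ℕ} {P Q u v w u₀ : Word}

theorem one_lt_count_of_inversion {u' : Word} (hza : z ≠ a) {v₁ v₂ : Word} (hv₁ : a ∉ v₁)
    (hB : BlockBalanced (P ++ v₁ ++ [z, a] ++ v₂) (P ++ a :: u')) :
    1 < (P ++ v₁ ++ [z, a] ++ v₂).count a ∧ 1 < (P ++ v₁ ++ [z, a] ++ v₂).count z := by
  have key : ∀ K : Finset ℕ, a ∈ K → z ∈ K →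
      restrict K (P ++ v₁ ++ [z, a] ++ v₂) ≠ restrict K (P ++ a :: u') := by
    intro K haK hzK h
    simp only [restrict_append, restrict_cons_of_mem haK, List.append_assoc,
      List.append_cancel_left_eq] at h
    rcases hh : restrict K v₁ with _ | ⟨b, g⟩
    · rw [hh, restrict_cons_of_mem hzK] at h
      exact hza (List.cons.inj h).1
    · rw [hh] at h
      have hb : b = a := (List.cons.inj h).1
      have hb' : b ∈ restrict K v₁ := by rw [hh]; simp
      exact hv₁ (hb ▸ (mem_restrict.1 hb').1)
  constructor
  · apply one_lt_count_of_notMem_lin (by simp)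
    intro ha
    exact key _ (Finset.mem_insert_of_mem ha) (by simp) (hB z)
  · apply one_lt_count_of_notMem_lin (by simp)
    intro hz
    exact key _ (by simp) (Finset.mem_insert_of_mem hz) (hB a)

/-- Sorting a word by interchanging adjacent occurrences of non-linear variables. -/
theorem sort_blockBalanced {R : Word → Word → Prop} {Inv : Word → Prop} (hrefl : ∀ w, R w w)
    (htrans : ∀ {u v w}, R u v → R v w → R u w)
    (hright : ∀ P Q x z, x ∈ Q → z ∈ Q → R (P ++ [x, z] ++ Q) (P ++ [z, x] ++ Q))
    (hleft : ∀ P Q x z, x ∈ P → z ∈ P → R (P ++ [x, z] ++ Q) (P ++ [z, x] ++ Q))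
    (hInv : ∀ {u v}, R u v → Inv u → Inv v)
    (hcrit₁ : ∀ P Q x y, x ≠ y → x ∈ P → x ∉ Q → y ∉ P → y ∈ Q → Inv (P ++ [y, x] ++ Q) →
      BlockBalanced (P ++ [y, x] ++ Q) u₀ → Precedes x y u₀ →
      R (P ++ [y, x] ++ Q) (P ++ [x, y] ++ Q))
    (hcrit₂ : ∀ P Q x y, x ≠ y → x ∈ P → x ∉ Q → y ∉ P → y ∈ Q → Inv (P ++ [x, y] ++ Q) →
      BlockBalanced (P ++ [x, y] ++ Q) u₀ → ¬ Precedes x y u₀ →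
      R (P ++ [x, y] ++ Q) (P ++ [y, x] ++ Q))
    {v : Word} (hv : Inv v) (hB : BlockBalanced v u₀) : R v u₀ := by
  have hstep : ∀ (P v₁ v₂ u' : Word) (z a : ℕ), P ++ a :: u' = u₀ → a ∉ v₁ → z ≠ a →
      Inv (P ++ v₁ ++ [z, a] ++ v₂) → BlockBalanced (P ++ v₁ ++ [z, a] ++ v₂) u₀ →
      R (P ++ v₁ ++ [z, a] ++ v₂) (P ++ v₁ ++ [a, z] ++ v₂) ∧
      BlockBalanced (P ++ v₁ ++ [a, z] ++ v₂) u₀ := by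
    intro P v₁ v₂ u' z a hu hav hza hI hBB
    obtain ⟨hca, hcz⟩ := one_lt_count_of_inversion hza hav (hu ▸ hBB)
    refine ⟨?_, (blockBalanced_swap _ _ hcz.ne' hca.ne').symm.trans hBB⟩
    have hcount := fun b => hBB.count_eq b
    have hma : a ∈ P ++ v₁ ∨ a ∈ v₂ := by
      have := mem_append_or_of_lt_count (A := P ++ v₁ ++ [z]) (D := v₂) (z := a) (by simpa using hca)
      simpa [hza.symm] using this
    have hmz : z ∈ P ++ v₁ ∨ z ∈ v₂ := by
      have := mem_append_or_of_lt_count (A := P ++ v₁) (D := a :: v₂) (z := z) (by simpa using hcz)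
      simpa [hza] using this
    by_cases ha : a ∈ v₂
    · by_cases hz : z ∈ v₂
      · exact hright _ _ _ _ hz ha
      · have hz' := hmz.resolve_right hz
        by_cases haP : a ∈ P ++ v₁
        · exact hleft _ _ _ _ hz' haP
        · refine hcrit₂ _ _ _ _ hza hz' hz haP ha hI hBB ?_
          intro hp
          rw [← hu, show P ++ a :: u' = (P ++ [a]) ++ u' by simp] at hp
          have hzu := hp.not_mem hza (by simp)
          have := hcount z
          rw [← hu] at this
          simp only [List.count_append, List.count_cons, List.count_nil, beq_self_eq_true, if_true,
            beq_iff_eq, hza.symm, if_false, List.count_eq_zero.2 hz, List.count_eq_zero.2 hzu] at this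
          omega
    · have haP := hma.resolve_right ha
      by_cases hz : z ∈ P ++ v₁
      · exact hleft _ _ _ _ hz haP
      · refine hcrit₁ _ _ _ _ hza.symm haP ha hz (hmz.resolve_left hz) hI hBB ?_
        have hau : a ∉ u' := by
          have := hcount a
          rw [← hu] at this
          simp only [List.count_append, List.count_cons, List.count_nil, beq_self_eq_true, if_true,
            beq_iff_eq, hza, if_false, List.count_eq_zero.2 ha, List.count_eq_zero.2 hav] at this
          exact List.count_eq_zero.1 (by omega)
        rw [← hu, show P ++ a :: u' = (P ++ [a]) ++ u' by simp]
        exact precedes_append (by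
          simp only [List.mem_append, not_or] at hz ⊢
          simp [hz.1, hza]) hau
  have hmove : ∀ (P v₁ v₂ u' : Word) (a : ℕ), P ++ a :: u' = u₀ → a ∉ v₁ →
      Inv (P ++ v₁ ++ [a] ++ v₂) → BlockBalanced (P ++ v₁ ++ [a] ++ v₂) u₀ →
      R (P ++ v₁ ++ [a] ++ v₂) (P ++ [a] ++ v₁ ++ v₂) ∧
      BlockBalanced (P ++ [a] ++ v₁ ++ v₂) u₀ := by
    intro P v₁
    induction v₁ using List.reverseRecOn with
    | nil => intro v₂ u' a _ _ _ hBB; exact ⟨by simpa using hrefl _, by simpa using hBB⟩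
    | append_singleton v₁ z ih =>
      intro v₂ u' a hu hav hI hBB
      have hza : z ≠ a := fun h => hav (by simp [h])
      have e : P ++ (v₁ ++ [z]) ++ [a] ++ v₂ = P ++ v₁ ++ [z, a] ++ v₂ := by simp
      rw [e] at hI hBB ⊢
      obtain ⟨h1, h2⟩ := hstep P v₁ v₂ u' z a hu (fun h => hav (by simp [h])) hza hI hBB
      have h3 := ih (z :: v₂) u' a hu (fun h => hav (by simp [h]))
        (by simpa using hInv h1 hI) (by simpa using h2)
      refine ⟨htrans h1 (by simpa using h3.1), by simpa using h3.2⟩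
  suffices ∀ u P v, P ++ u = u₀ → Inv (P ++ v) → BlockBalanced (P ++ v) u₀ → R (P ++ v) (P ++ u) from
    this u₀ [] v rfl hv hB
  intro u
  induction u with
  | nil =>
    intro P v hu _ hBB
    have : v = [] := by
      rw [← hu] at hBB
      have := hBB.perm.length_eq
      simpa using this
    rw [this]
    exact hrefl _
  | cons a u ih =>
    intro P v hu hI hBB
    have hav : a ∈ v := by
      have := hBB.count_eq a
      rw [← hu, List.count_append, List.count_append, List.count_cons_self] at this
      exact List.count_pos_iff.1 (by omega)
    obtain ⟨v₁, v₂, rfl, hav₁⟩ := exists_eq_append_first hav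
    obtain ⟨h1, h2⟩ := hmove P v₁ v₂ u a hu hav₁ (by simpa using hI) (by simpa using hBB)
    have h3 := ih (P ++ [a]) (v₁ ++ v₂) (by simpa using hu) (by
      have := hInv h1 (by simpa using hI)
      simpa using this) (by simpa using h2)
    exact htrans (by simpa using h1) (by simpa using h3)

theorem precedes_swap_iff (hab : a ≠ b) (h : x ∈ P ∧ z ∈ P ∨ x ∈ Q ∧ z ∈ Q) :
    Precedes a b (P ++ [x, z] ++ Q) ↔ Precedes a b (P ++ [z, x] ++ Q) := by
  rcases eq_or_ne x z with rfl | hxz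
  · rfl
  by_cases hx : x ∈ ({a, b} : Finset ℕ)
  · by_cases hz : z ∈ ({a, b} : Finset ℕ)
    · have key : ∀ c d, c ≠ d → c ∈ ({a, b} : Finset ℕ) → d ∈ ({a, b} : Finset ℕ) →
          (c ∈ P ∧ d ∈ P ∨ c ∈ Q ∧ d ∈ Q) → ¬ Precedes a b (P ++ [c, d] ++ Q) := by
        intro c d hcd hc hd h hp
        have hba : (a ∈ P ∧ b ∈ P) ∨ (a ∈ Q ∧ b ∈ Q) := by
          simp only [Finset.mem_insert, Finset.mem_singleton] at hc hd
          rcases hc with rfl | rfl <;> rcases hd with rfl | rfl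
          · exact absurd rfl hcd
          · exact h
          · exact h.imp And.symm And.symm
          · exact absurd rfl hcd
        have hacd : a ∈ [c, d] ∧ b ∈ [c, d] := by
          simp only [Finset.mem_insert, Finset.mem_singleton] at hc hd
          rcases hc with rfl | rfl <;> rcases hd with rfl | rfl
          · exact absurd rfl hcd
          · simp
          · simp
          · exact absurd rfl hcd
        rcases hba with ⟨ha, hb⟩ | ⟨ha, hb⟩
        · rw [List.append_assoc] at hp
          exact hp.not_mem hab hb (by simp only [List.mem_append]; exact .inl hacd.1)
        · exact hp.not_mem hab (by simp only [List.mem_append]; exact .inr hacd.2) ha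
      exact iff_of_false (key x z hxz hx hz h)
        (key z x hxz.symm hz hx (h.imp And.symm And.symm))
    · have e : restrict {a, b} (P ++ [x, z] ++ Q) = restrict {a, b} (P ++ [z, x] ++ Q) := by
        simp [restrict_cons_of_not_mem hz, restrict_cons_of_mem hx]
      exact ⟨fun h => h.congr e, fun h => h.congr e.symm⟩
  · have e : restrict {a, b} (P ++ [x, z] ++ Q) = restrict {a, b} (P ++ [z, x] ++ Q) := by
      simp only [restrict_append, restrict_cons_of_not_mem hx]
      by_cases hz : z ∈ ({a, b} : Finset ℕ)
      · simp [restrict_cons_of_mem hz, restrict_cons_of_not_mem hx]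
      · simp [restrict_cons_of_not_mem hz, restrict_cons_of_not_mem hx]
    exact ⟨fun h => h.congr e, fun h => h.congr e.symm⟩

theorem not_precedes_swap (hxy : x ≠ y) :
    ¬ Precedes x y (P ++ [y, x] ++ Q) := by
  intro h
  have := h.congr (v := (P ++ [y]) ++ ([x] ++ Q)) (by simp)
  exact this.not_mem hxy (by simp) (by simp)

/-- Two words that agree up to the order inside blocks, and in which the same pairs of non-linear
variables are separated, are equivalent modulo commutations. -/
theorem Commutes.derives_of_precedes_iff (hE : Commutes E) (hB : BlockBalanced v u)
    (h : ∀ x y, x ≠ y → 1 < u.count x → 1 < u.count y → (Precedes x y v ↔ Precedes x y u)) :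
    Derives E v u := by
  have := sort_blockBalanced (u₀ := u) (v := v)
    (R := fun w w' => Derives E w w' ∧ ∀ x y, x ≠ y → (Precedes x y w ↔ Precedes x y w'))
    (Inv := fun w => ∀ x y, x ≠ y → 1 < u.count x → 1 < u.count y →
      (Precedes x y w ↔ Precedes x y u))
    (fun w => ⟨.refl w, fun _ _ _ => Iff.rfl⟩)
    (fun h h' => ⟨h.1.trans h'.1, fun x y hxy => (h.2 x y hxy).trans (h'.2 x y hxy)⟩)
    (fun P Q x z hx hz => ⟨hE.of_mem_right hx hz, fun a b hab =>
      precedes_swap_iff hab (.inr ⟨hx, hz⟩)⟩)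
    (fun P Q x z hx hz => ⟨hE.of_mem_left hx hz, fun a b hab =>
      precedes_swap_iff hab (.inl ⟨hx, hz⟩)⟩)
    (fun h h' x y hxy hx hy => (h.2 x y hxy).symm.trans (h' x y hxy hx hy)) ?_ ?_ h hB
  · exact this.1
  · intro P Q x y hxy hxP hxQ hyP hyQ hI hBB hp
    exfalso
    have h1 := List.count_pos_iff.2 hxP
    have h2 := List.count_pos_iff.2 hyQ
    refine not_precedes_swap hxy ((hI x y hxy ?_ ?_).2 hp)
    · rw [← hBB.count_eq]
      simp only [List.count_append, List.count_cons, List.count_nil, beq_self_eq_true, if_true]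
      omega
    · rw [← hBB.count_eq]
      simp only [List.count_append, List.count_cons, List.count_nil, beq_self_eq_true, if_true]
      omega
  · intro P Q x y hxy hxP hxQ hyP hyQ hI hBB hp
    exfalso
    have h1 := List.count_pos_iff.2 hxP
    have h2 := List.count_pos_iff.2 hyQ
    refine hp ((hI x y hxy ?_ ?_).1 ?_)
    · rw [← hBB.count_eq]
      simp only [List.count_append, List.count_cons, List.count_nil, beq_self_eq_true, if_true]
      omega
    · rw [← hBB.count_eq]
      simp only [List.count_append, List.count_cons, List.count_nil, beq_self_eq_true, if_true]
      omega
    · have := precedes_append (P := P ++ [x]) (Q := [y] ++ Q) (x := x) (y := y)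
        (by simp [hyP, hxy.symm]) (by simp [hxQ, hxy])
      simpa using this

theorem Precedes.trans_of_mem (hxz : Precedes z y w) (hyx : Precedes y x w) (hzy : z ≠ y)
    (hyx' : y ≠ x) (hy : y ∈ w) : Precedes z x w := by
  obtain ⟨w₁, w₂, rfl, -⟩ := exists_eq_append_first hy
  have h1 := hxz.not_mem hzy (by simp)
  refine precedes_append ?_ h1
  have h2 : x ∉ w₁ := by
    intro hx
    rw [List.append_assoc] at hyx
    exact hyx.not_mem hyx' hx (by simp)
  simp [h2, hyx'.symm]

end Sorting

section CriticalPairs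

variable {S : Type*} [Monoid S] {m : ℕ} {E : Set (Word × Word)}
variable {x y z : ℕ} {p q u v w M N P Q U V : Word} {L : Finset ℕ}

/-- `P` can be rearranged, modulo `E` and independently of what follows, into an instance of `U`. -/
def LeftInstance (E : Set (Word × Word)) (L : Finset ℕ) (x : ℕ) (P U : Word) : Prop :=
  ∃ (C : Word) (θ : ℕ → Word) (P' : Word), θ x = [x] ∧ P' = C ++ U.flatMap θ ∧ P'.Perm P ∧
    ∀ R, x ∈ R → (∀ z ∈ P, z ∉ L → 1 < (P ++ R).count z) → Derives E (P ++ R) (P' ++ R)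

/-- After `P`, followed by `x y` or `y x`, the word `Q` can be rearranged into an instance of
`V`. -/
def RightInstance (E : Set (Word × Word)) (L : Finset ℕ) (x y : ℕ) (Q V : Word) : Prop :=
  ∃ (D : Word) (θ : ℕ → Word) (Q' : Word), θ y = [y] ∧ Q' = V.flatMap θ ++ D ∧
    ∀ P, x ∈ P → (∀ z ∈ Q, z ∉ L → 1 < (P ++ [x, y] ++ Q).count z) →
      Derives E (P ++ [x, y] ++ Q) (P ++ [x, y] ++ Q') ∧
      Derives E (P ++ [y, x] ++ Q) (P ++ [y, x] ++ Q')

theorem IsRichBasis.derives_of_instances (hE : IsRichBasis S m E) (hsw : IsSwap S x y U V)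
    (hx : x ∈ P) (hL : ∀ z, z ∈ P ∨ z ∈ Q → z ∉ L → 1 < (P ++ [x, y] ++ Q).count z)
    (hP : LeftInstance E L x P U) (hQ : RightInstance E L x y Q V) :
    Derives E (P ++ [x, y] ++ Q) (P ++ [y, x] ++ Q) := by
  obtain ⟨C, θ₁, P', h1, e1, hperm, hP'⟩ := hP
  obtain ⟨D, θ₂, Q', h2, e2, hQ'⟩ := hQ
  have hc : ∀ z, (P' ++ [x, y] ++ Q).count z = (P ++ [x, y] ++ Q).count z := fun z =>
    ((hperm.append_right _).append_right _).count_eq z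
  have hc' : ∀ z, (P ++ [y, x] ++ Q).count z = (P ++ [x, y] ++ Q).count z := fun z =>
    (swap_perm _ _ _ _).count_eq z
  have h3 := hP' ([x, y] ++ Q) (by simp) (fun z hz hzL => by
    have := hL z (.inl hz) hzL
    simpa using this)
  have h4 := hP' ([y, x] ++ Q) (by simp) (fun z hz hzL => by
    have := hL z (.inl hz) hzL
    rw [← hc'] at this
    simpa using this)
  obtain ⟨h5, h6⟩ := hQ' P' (hperm.mem_iff.2 hx) (fun z hz hzL => by
    rw [hc]
    exact hL z (.inr hz) hzL)
  have h7 := hsw.derives hE.swap h1 h2 C D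
  rw [← e1, List.append_assoc _ _ D, ← e2, List.append_assoc _ _ D, ← e2] at h7
  rw [← List.append_assoc, ← List.append_assoc] at h3 h4
  exact h3.trans (h5.trans (h7.trans (h6.symm.trans h4.symm)))

theorem Gathered.exists_left (hx : x ∉ L) (hG : Gathered x L (P ++ [x]))
    (hL : ∀ t ∈ L, (P ++ [x]).count t ≤ 1) :
    ∃ (C : Word) (θ : ℕ → Word), θ x = [x] ∧ P = C ++ (restrict (insert x L) P).flatMap θ := by
  obtain ⟨C, D, θ, e, hC, hD, hθx, -, -⟩ := hG.exists_eq_flatMap hx hL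
  refine ⟨C, θ, hθx, ?_⟩
  rcases List.eq_nil_or_concat D with rfl | ⟨D', a, rfl⟩
  · rw [restrict_append, restrict_cons_of_mem (by simp), List.flatMap_append] at e
    simp only [restrict_nil, List.flatMap_cons, List.flatMap_nil, hθx, List.append_nil] at e
    rw [← List.append_assoc] at e
    exact List.append_cancel_right e
  · exfalso
    have h1 := congrArg List.getLast? e
    rw [List.concat_eq_append, ← List.append_assoc, List.getLast?_concat, List.getLast?_concat] at h1
    obtain rfl : x = a := by simpa using h1
    rw [restrict_eq_nil_iff] at hD
    exact hD x (by simp) (by simp)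

theorem Gathered.exists_right (hx : x ∉ L) (hG : Gathered x L ([x] ++ Q))
    (hL : ∀ t ∈ L, ([x] ++ Q).count t ≤ 1) :
    ∃ (D : Word) (θ : ℕ → Word), θ x = [x] ∧ Q = (restrict (insert x L) Q).flatMap θ ++ D := by
  obtain ⟨C, D, θ, e, hC, hD, hθx, -, -⟩ := hG.exists_eq_flatMap hx hL
  refine ⟨D, θ, hθx, ?_⟩
  cases C with
  | nil =>
    rw [restrict_append, restrict_cons_of_mem (by simp), List.flatMap_append] at e
    simpa [hθx] using e
  | cons a C =>
    exfalso
    have h1 : x = a := by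
      have := congrArg List.head? e
      simpa using this
    subst h1
    rw [restrict_eq_nil_iff] at hC
    exact hC x (by simp) (by simp)

theorem Commutes.leftInstance_restrict (hE : Commutes E) (hx : x ∉ L) (hp : x ∉ p)
    (hM : ∃ z ∈ M, z ∈ L) (hL : ∀ t ∈ L, (p ++ [x] ++ M).count t ≤ 1) :
    LeftInstance E L x (p ++ [x] ++ M) (restrict (insert x L) (p ++ [x] ++ M)) := by
  obtain ⟨M₀, h1, h2, h3, h4⟩ := hE.exists_gather hx hM
  have hperm : (p ++ [x] ++ M₀).Perm (p ++ [x] ++ M) := (perm_of_filter_eq h1 h2).append_left _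
  have hG : Gathered x L ((p ++ [x] ++ M₀) ++ [x]) := by simpa using h3 p [] hp (by simp)
  obtain ⟨C, θ, hθ, e⟩ := hG.exists_left hx (fun t ht => by
    have hxt : x ≠ t := fun h => hx (h ▸ ht)
    rw [(hperm.append_right _).count_eq, List.count_append]
    have := hL t ht
    simpa [hxt] using this)
  have hres : restrict (insert x L) (p ++ [x] ++ M₀) = restrict (insert x L) (p ++ [x] ++ M) := by
    rw [restrict_append, h2, ← restrict_append]
  refine ⟨C, θ, _, hθ, hres ▸ e, hperm, ?_⟩
  intro R hR hz
  exact h4 (p ++ [x]) R (by simp) hR (fun z hzM hzL => hz z (by simp [hzM]) hzL)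

theorem Commutes.leftInstance_pw (hE : Commutes E) (hM : ∀ z ∈ M, z ∉ L) {i j t : ℕ}
    (ht : t ≠ x) (hij : i + j = M.count x) :
    LeftInstance E L x (p ++ [x] ++ M) (pw x (i + 1) ++ [t] ++ pw x j) := by
  refine ⟨p, fun z => if z = x then [x] else M.filter (· ≠ x),
    p ++ [x] ++ (pw x i ++ M.filter (· ≠ x) ++ pw x j), by simp, ?_, ?_, ?_⟩
  · rw [List.flatMap_append, List.flatMap_append, pw_flatMap (y := x) _ (by simp),
      pw_flatMap (y := x) _ (by simp), pw_succ]
    simp [ht]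
  · exact ((pw_filter_perm x M hij).symm).append_left _
  · intro R hR hz
    exact hE.push_both (by simp) hR (fun z hzM => hz z (by simp [hzM]) (hM z hzM)) hij

theorem Commutes.rightInstance_pw (hE : Commutes E) (hN : ∀ z ∈ N, z ∉ L) {i j t : ℕ}
    (ht : t ≠ y) (hij : i + j = N.count y) :
    RightInstance E L x y (N ++ [y] ++ q) (pw y i ++ [t] ++ pw y (j + 1)) := by
  refine ⟨q, fun z => if z = y then [y] else N.filter (· ≠ y),
    pw y i ++ N.filter (· ≠ y) ++ pw y j ++ [y] ++ q, by simp, ?_, ?_⟩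
  · rw [List.flatMap_append, List.flatMap_append, pw_flatMap (y := y) _ (by simp),
      pw_flatMap (y := y) _ (by simp), pw_succ']
    simp [ht]
  · intro P _ hz
    constructor
    · have := hE.push_both (P := P ++ [x, y]) (Q := [y] ++ q) (B := N) (x := y) (by simp) (by simp)
        (fun z hzN => by simpa using hz z (by simp [hzN]) (hN z hzN)) hij
      simpa using this
    · have := hE.push_both (P := P ++ [y, x]) (Q := [y] ++ q) (B := N) (x := y) (by simp) (by simp)
        (fun z hzN => by
          have := hz z (by simp [hzN]) (hN z hzN)
          rw [(swap_perm _ _ _ _).count_eq] at this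
          simpa using this) hij
      simpa using this

theorem Commutes.rightInstance_restrict (hE : Commutes E) (hy : y ∉ L) (hq : y ∉ q)
    (hN : ∃ z ∈ N, z ∈ L) (hL : ∀ t ∈ L, (N ++ [y] ++ q).count t ≤ 1) :
    RightInstance E L x y (N ++ [y] ++ q) (restrict (insert y L) (N ++ [y] ++ q)) := by
  obtain ⟨N₀, h1, h2, h3, h4⟩ := hE.exists_gather hy hN
  have hperm : (N₀ ++ [y] ++ q).Perm (N ++ [y] ++ q) :=
    ((perm_of_filter_eq h1 h2).append_right _).append_right _
  have hG : Gathered y L ([y] ++ (N₀ ++ [y] ++ q)) := by simpa using h3 [] q (by simp) hq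
  obtain ⟨D, θ, hθ, e⟩ := hG.exists_right hy (fun t ht => by
    have hyt : y ≠ t := fun h => hy (h ▸ ht)
    rw [(hperm.append_left _).count_eq, List.count_append]
    have := hL t ht
    simpa [hyt] using this)
  have hres : restrict (insert y L) (N₀ ++ [y] ++ q) = restrict (insert y L) (N ++ [y] ++ q) := by
    simp only [restrict_append, h2]
  refine ⟨D, θ, _, hθ, hres ▸ e, ?_⟩
  intro P _ hz
  constructor
  · have := h4 (P ++ [x, y]) ([y] ++ q) (by simp) (by simp) (fun z hzN hzL => by
      simpa using hz z (by simp [hzN]) hzL)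
    simpa using this
  · have := h4 (P ++ [y, x]) ([y] ++ q) (by simp) (by simp) (fun z hzN hzL => by
      have := hz z (by simp [hzN]) hzL
      rw [(swap_perm _ _ _ _).count_eq] at this
      simpa using this)
    simpa using this

theorem Commutes.pw_move_left (hE : Commutes E) (hx : x ∈ P) (hy : y ∈ P) (e : ℕ) :
    Derives E (P ++ pw y e ++ [x] ++ Q) (P ++ [x] ++ pw y e ++ Q) := by
  induction e generalizing Q with
  | zero => simpa [pw] using Derives.refl _
  | succ e ih =>
    have h1 := hE.of_mem_left (P := P ++ pw y e) (Q := Q) (x := y) (z := x) (by simp [hy])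
      (by simp [hx])
    have h2 := ih (Q := [y] ++ Q)
    rw [pw_succ']
    exact Derives.trans (by simpa using h1) (by simpa using h2)

theorem IsRichBasis.rightInstance_restrict (hE : IsRichBasis S m E) (hy : y ∉ L) (hxy : x ≠ y)
    (hq : y ∉ q) (hN : ∀ z ∈ N, z ∉ L) (hc : m ≤ N.count y + 1) (hL : ∀ t ∈ L, (N ++ [y] ++ q).count t ≤ 1) :
    RightInstance E L x y (N ++ [y] ++ q) (restrict (insert y L) (N ++ [y] ++ q)) := by
  have hperm : (pw y (N.count y + 1) ++ N.filter (· ≠ y) ++ q).Perm (N ++ [y] ++ q) := by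
    rw [List.perm_iff_count]
    intro z
    have := (pw_filter_perm y N (i := N.count y) (j := 0) (by simp)).count_eq z
    simp only [pw_succ', List.count_append, this, pw, List.replicate_zero, List.count_nil]
    omega
  have hNq : y ∉ N.filter (· ≠ y) ++ q := by simp [hq]
  have hG : Gathered y L ([y] ++ (pw y (N.count y + 1) ++ N.filter (· ≠ y) ++ q)) := by
    have := (gathered_of_notMem (L := L) hNq).pw_append (fun h => absurd h.mem hNq) (N.count y + 2)
    rw [show N.count y + 2 = (N.count y + 1) + 1 from rfl, pw_succ] at this
    simpa using this
  obtain ⟨D, θ, hθ, e⟩ := hG.exists_right hy (fun t ht => by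
    have hyt : y ≠ t := fun h => hy (h ▸ ht)
    rw [(hperm.append_left _).count_eq, List.count_append]
    have := hL t ht
    simpa [hyt] using this)
  have hres : restrict (insert y L) (pw y (N.count y + 1) ++ N.filter (· ≠ y) ++ q) =
      restrict (insert y L) (N ++ [y] ++ q) := by
    have e2 : restrict (insert y L) (N.filter (· ≠ y)) = [] := by
      rw [restrict_eq_nil_iff]
      intro z hz
      obtain ⟨h1, h2⟩ := List.mem_filter.1 hz
      have h2 : z ≠ y := by simpa using h2
      simp [h2, hN z h1]
    simp only [restrict_append, e2, restrict_eq_pw_of_disjoint hN, List.append_nil]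
    rw [restrict_eq_self (fun z hz => by simp [(mem_pw_iff.1 hz).2]), pw_succ',
      restrict_cons_of_mem (by simp), restrict_nil]
  refine ⟨D, θ, _, hθ, hres ▸ e, ?_⟩
  intro P hxP hz
  constructor
  · have := hE.gather (p := P ++ [x]) (M := N) (x := y) (q := q) hc (fun z hzN => by
      simpa using hz z (by simp [hzN]) (hN z hzN))
    rw [show N.count y + 2 = (N.count y + 1) + 1 from rfl, pw_succ] at this
    simpa using this
  · have h1 := hE.gather (p := P) (M := x :: N) (x := y) (q := q)
      (by simpa [List.count_cons, hxy] using hc) (fun z hzN => by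
        have h2 : 1 < (P ++ [x, y] ++ (N ++ [y] ++ q)).count z := by
          rcases List.mem_cons.1 hzN with rfl | hzN
          · have := List.count_pos_iff.2 hxP
            simp only [List.count_append, List.count_cons, List.count_nil, beq_self_eq_true, if_true]
            omega
          · exact hz z (by simp [hzN]) (hN z hzN)
        rw [(swap_perm _ _ _ _).count_eq] at h2
        simpa using h2)
    have h2 := hE.comm.pw_move_left (P := P ++ [y]) (x := x) (y := y)
      (Q := N.filter (· ≠ y) ++ q) (by simp [hxP]) (by simp) (N.count y + 1)
    have e3 : (x :: N).count y = N.count y := by simp [hxy]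
    have e4 : (x :: N).filter (· ≠ y) = x :: N.filter (· ≠ y) := by simp [hxy]
    rw [e3, e4, show N.count y + 2 = (N.count y + 1) + 1 from rfl, pw_succ] at h1
    exact Derives.trans (by simpa using h1) (by simpa using h2)

end CriticalPairs

section Completeness

variable {S : Type*} [Monoid S] {m : ℕ} {E : Set (Word × Word)}
variable {x y z : ℕ} {p q u v w M N P Q U V : Word} {L : Finset ℕ}

theorem count_restrict_le {X : Finset ℕ} : (restrict X u).count z ≤ u.count z :=
  List.Sublist.count_le z List.filter_sublist

theorem bUnstable_restrict {X : Finset ℕ} (hx : x ∈ X) (hy : y ∈ X) (hs : Satisfies S w v)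
    (hB : BlockBalanced w v) (hp : Precedes x y w) (hp' : ¬ Precedes x y v) (hxw : x ∈ w) :
    BUnstable S x y (restrict X w) := by
  have hsub : ({x, y} : Finset ℕ) ⊆ X := by simp [Finset.insert_subset_iff, hx, hy]
  refine ⟨restrict X v, ?_, hs.restrict X, hB.restrict X, ?_⟩
  · exact List.ne_nil_of_mem (mem_restrict.2 ⟨hB.perm.mem_iff.1 hxw, hx⟩)
  · rw [restrict_restrict_of_subset hsub, restrict_restrict_of_subset hsub]
    exact fun h => hp' (hp.congr h)

/-- If a block-balanced identity of `S` separates `x` from `y`, and `x` is not confined to one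
block, then the last occurrence of `x` and the first occurrence of `y` may be interchanged. -/
theorem IsRichBasis.satisfies_swap (hE : IsRichBasis S m E) (hxy : x ≠ y)
    (hB : BlockBalanced (U ++ [x, y] ++ V) v) (hs : Satisfies S (U ++ [x, y] ++ V) v)
    (hp : ¬ Precedes x y v) (hx : x ∈ U) (hy : y ∉ U) (hyV : y ∈ V)
    (hnl : ∀ z, z ≠ x → z ≠ y → (U ++ [x, y] ++ V).count z ≤ 1) (hzlin : z ∈ lin (U ++ [x, y] ++ V))
    (hzU : z ∈ U) (hxz : ¬ Precedes z x U) :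
    Satisfies S (U ++ [x, y] ++ V) (U ++ [y, x] ++ V) := by
  have hcx : 1 < (U ++ [x, y] ++ V).count x := by
    have := List.count_pos_iff.2 hx
    simp only [List.count_append, List.count_cons_self]
    omega
  have hcy : 1 < (U ++ [x, y] ++ V).count y := by
    have := List.count_pos_iff.2 hyV
    simp only [List.count_append, List.count_cons, List.count_nil, beq_self_eq_true, if_true]
    omega
  have hz1 := mem_lin.1 hzlin
  have hzx : z ≠ x := by rintro rfl; omega
  have hzy : z ≠ y := by rintro rfl; omega
  have hzV : z ∉ [x, y] ++ V := by
    have := List.count_pos_iff.2 hzU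
    rw [List.append_assoc, List.count_append] at hz1
    exact List.count_eq_zero.1 (by omega)
  have hsw := blockBalanced_swap U V hcx.ne' hcy.ne'
  have hpair : ∀ a, restrict {z, a} (U ++ [x, y] ++ V) = restrict {z, a} v := fun a =>
    restrict_eq_of_subset (by
      intro b
      simp only [Finset.mem_insert, Finset.mem_singleton]
      rintro (rfl | rfl)
      · exact .inr hzlin
      · exact .inl rfl) (hB a)
  have hyx : ¬ Precedes y x v := by
    intro h
    have h1 : Precedes z y v := by
      refine Precedes.congr ?_ (hpair y)
      have := precedes_append (x := z) (y := y) hy hzV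
      simpa using this
    have h2 := (h1.trans_of_mem h hzy hxy.symm (hB.perm.mem_iff.1 (by simp))).congr (hpair x).symm
    rcases List.append_of_mem hzU with ⟨U₁, U₂, rfl⟩
    have hU₂ : z ∉ U₁ ∧ z ∉ U₂ := by
      have : (U₁ ++ z :: U₂ ++ [x, y] ++ V).count z =
        U₁.count z + U₂.count z + 1 + ([x, y] ++ V).count z := by
        simp only [List.count_append, List.count_cons_self]
        omega
      exact ⟨List.count_eq_zero.1 (by omega), List.count_eq_zero.1 (by omega)⟩
    apply hxz
    have hxU₁ : x ∉ U₁ := by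
      intro hx1
      rw [show U₁ ++ z :: U₂ ++ [x, y] ++ V = U₁ ++ (z :: U₂ ++ [x, y] ++ V) by simp] at h2
      exact h2.not_mem hzx hx1 (by simp)
    have := precedes_append (P := U₁ ++ [z]) (Q := U₂) (x := z) (y := x) (by simp [hxU₁, hzx.symm])
      hU₂.2
    simpa using this
  have hd := hE.comm.derives_of_precedes_iff (hB.symm.trans hsw) (by
    intro a b hab ha hb
    rw [← (swap_perm _ _ _ _).count_eq] at ha hb
    have key : ∀ a, 1 < (U ++ [x, y] ++ V).count a → a = x ∨ a = y := by
      intro a ha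
      by_contra! hc
      have := hnl a hc.1 hc.2
      omega
    rcases key a ha with rfl | rfl
    · rcases key b hb with rfl | rfl
      · exact absurd rfl hab
      · exact iff_of_false hp (not_precedes_swap hxy)
    · rcases key b hb with rfl | rfl
      · refine iff_of_false hyx (fun h => ?_)
        rw [List.append_assoc] at h
        exact h.not_mem hab hx (by simp)
      · exact absurd rfl hab)
  exact hs.trans (hd.sound hE.sound)

theorem count_pw_append_le {i j t : ℕ} (hz : z ≠ x) : (pw x i ++ [t] ++ pw x j).count z ≤ 1 := by
  rw [List.count_append, List.count_append, count_pw_of_ne hz, count_pw_of_ne hz]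
  simp only [List.count_cons, List.count_nil]
  split <;> omega

/-- A pair of variables that is separated by an identity of `S` may be separated by means of the
identities in `E`. -/
theorem IsRichBasis.critical (hE : IsRichBasis S m E) (hxy : x ≠ y) (hxP : x ∈ P) (hxQ : x ∉ Q)
    (hyP : y ∉ P) (hyQ : y ∈ Q)
    (hs : Satisfies S (restrict (insert x (insert y (lin (P ++ [x, y] ++ Q)))) (P ++ [x, y] ++ Q)) v)
    (hB : BlockBalanced
      (restrict (insert x (insert y (lin (P ++ [x, y] ++ Q)))) (P ++ [x, y] ++ Q)) v)
    (hp : ¬ Precedes x y v) : Derives E (P ++ [x, y] ++ Q) (P ++ [y, x] ++ Q) := by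
  have hcx : (P ++ [x, y] ++ Q).count x = P.count x + 1 := by
    simp [hxy.symm, List.count_eq_zero.2 hxQ]
  have hcy : (P ++ [x, y] ++ Q).count y = Q.count y + 1 := by
    simp [hxy, List.count_eq_zero.2 hyP]
  have hx1 := List.count_pos_iff.2 hxP
  have hy1 := List.count_pos_iff.2 hyQ
  set L := lin (P ++ [x, y] ++ Q) with hLdef
  have hLcount : ∀ t ∈ L, P.count t + Q.count t ≤ 1 := by
    intro t ht
    have := mem_lin.1 ht
    rw [List.count_append, List.count_append] at this
    omega
  have hnlin : ∀ z, z ∈ P ∨ z ∈ Q → z ∉ L → 1 < (P ++ [x, y] ++ Q).count z := by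
    intro z hz hzL
    refine one_lt_count_of_notMem_lin ?_ hzL
    rcases hz with hz | hz <;> simp [hz]
  have hxL : x ∉ L := by rw [hLdef, mem_lin]; omega
  have hyL : y ∉ L := by rw [hLdef, mem_lin]; omega
  have hU : restrict (insert x (insert y L)) P = restrict (insert x L) P := by
    apply restrict_congr
    intro z hz
    have : z ≠ y := fun h => hyP (h ▸ hz)
    simp [this]
  have hV : restrict (insert x (insert y L)) Q = restrict (insert y L) Q := by
    apply restrict_congr
    intro z hz
    have : z ≠ x := fun h => hxQ (h ▸ hz)
    simp [this]
  have hW : restrict (insert x (insert y L)) (P ++ [x, y] ++ Q) =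
      restrict (insert x L) P ++ [x, y] ++ restrict (insert y L) Q := by
    rw [restrict_append, restrict_append, hU, hV, restrict_eq_self (u := [x, y]) (by simp)]
  rw [hW] at hs hB
  set U := restrict (insert x L) P with hUdef
  set V := restrict (insert y L) Q with hVdef
  have hmemU : ∀ z ∈ U, z ∈ P ∧ (z = x ∨ z ∈ L) := fun z hz => by
    simpa using mem_restrict.1 hz
  have hmemV : ∀ z ∈ V, z ∈ Q ∧ (z = y ∨ z ∈ L) := fun z hz => by
    simpa using mem_restrict.1 hz
  have hPQ : ∀ z ∈ L, z ∈ P → z ∉ Q := fun z hzL hzP hzQ => by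
    have h1 := List.count_pos_iff.2 hzP
    have h2 := List.count_pos_iff.2 hzQ
    have := hLcount z hzL
    omega
  have hUV : ∀ z ∈ U, z ∉ V := fun z hz hz' => by
    rcases (hmemU z hz).2 with rfl | h
    · exact hxQ (hmemV z hz').1
    · exact hPQ z h (hmemU z hz).1 (hmemV z hz').1
  have hcountU : ∀ z, z ≠ x → U.count z ≤ 1 := by
    intro z hz
    by_cases hzL : z ∈ L
    · have := hLcount z hzL
      exact (count_restrict_le (u := P)).trans (by omega)
    · rw [hUdef, count_restrict_of_not_mem (by simp [hz, hzL])]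
      omega
  have hcountV : ∀ z, z ≠ y → V.count z ≤ 1 := by
    intro z hz
    by_cases hzL : z ∈ L
    · have := hLcount z hzL
      exact (count_restrict_le (u := Q)).trans (by omega)
    · rw [hVdef, count_restrict_of_not_mem (by simp [hz, hzL])]
      omega
  have hxU : x ∈ U := mem_restrict.2 ⟨hxP, by simp⟩
  have hyU : y ∉ U := fun h => hyP (hmemU y h).1
  have hyV : y ∈ V := mem_restrict.2 ⟨hyQ, by simp⟩
  have hxV : x ∉ V := fun h => hxQ (hmemV x h).1
  have hprec : Precedes x y (U ++ [x, y] ++ V) := by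
    have := precedes_append (P := U ++ [x]) (Q := [y] ++ V) (x := x) (y := y)
      (by simp [hyU, hxy.symm]) (by simp [hxV, hxy])
    simpa using this
  have hcUx : (U ++ [x, y] ++ V).count x = P.count x + 1 := by
    rw [← hW, count_restrict_of_mem (by simp), hcx]
  have hcUy : (U ++ [x, y] ++ V).count y = Q.count y + 1 := by
    rw [← hW, count_restrict_of_mem (by simp), hcy]
  have hbig : ¬ (P.count x + 1 ≤ m ∧ Q.count y + 1 ≤ m) := by
    rintro ⟨h1, h2⟩
    exact hp (hprec.congr (Isoterm.restrict_eq hE.pos hE.iso hs hxy hprec (by omega) (by omega)))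
  obtain ⟨t, ht⟩ := Infinite.exists_notMem_finset (U ++ [x, y] ++ V).toFinset
  simp only [List.mem_toFinset, List.mem_append, List.mem_cons, List.not_mem_nil, or_false,
    not_or] at ht
  obtain ⟨⟨htU, htx, hty⟩, htV⟩ := ht
  obtain ⟨p, M, hP, hxp⟩ := exists_eq_append_first hxP
  obtain ⟨N, q, hQ, hyq⟩ := exists_eq_append_last hyQ
  have hPx : P.count x = M.count x + 1 := by
    rw [hP]; simp [List.count_eq_zero.2 hxp]
  have hQy : Q.count y = N.count y + 1 := by
    rw [hQ]; simp [List.count_eq_zero.2 hyq]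
  have hright : (∃ z ∈ N, z ∈ L) ∨ m ≤ N.count y + 1 → RightInstance E L x y Q V := by
    intro h
    rw [hVdef, hQ]
    by_cases hN : ∃ z ∈ N, z ∈ L
    · exact hE.comm.rightInstance_restrict hyL hyq hN (fun t ht => by
        have := hLcount t ht
        rw [← hQ]
        omega)
    · refine hE.rightInstance_restrict hyL hxy hyq (by simpa using hN) (h.resolve_left hN)
        (fun t ht => by
          have := hLcount t ht
          rw [← hQ]
          omega)
  by_cases hM : ∃ z ∈ M, z ∈ L
  · have hleft : LeftInstance E L x P U := by
      rw [hUdef, hP]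
      exact hE.comm.leftInstance_restrict hxL hxp hM (fun t ht => by
        have := hLcount t ht
        rw [← hP]
        omega)
    by_cases hN : (∃ z ∈ N, z ∈ L) ∨ m ≤ N.count y + 1
    · obtain ⟨z, hzM, hzL⟩ := hM
      have hzx : z ≠ x := fun h => hxL (h ▸ hzL)
      have hsub : ({z, x} : Finset ℕ) ⊆ insert x L := by
        simp [Finset.insert_subset_iff, hzL]
      have hsat := hE.satisfies_swap (z := z) hxy hB hs hp hxU hyU hyV (by
        intro z hzx hzy
        have h1 := hcountU z hzx
        have h2 := hcountV z hzy
        rw [List.count_append, List.count_append]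
        by_cases hzU : z ∈ U
        · rw [List.count_eq_zero.2 (hUV z hzU)]
          simpa [List.count_cons, Ne.symm hzx, Ne.symm hzy] using h1
        · rw [List.count_eq_zero.2 hzU]
          simpa [List.count_cons, Ne.symm hzx, Ne.symm hzy] using h2)
        (by
          rw [mem_lin, ← hW, count_restrict_of_mem (by simp [hzL])]
          exact mem_lin.1 hzL)
        (mem_restrict.2 ⟨by rw [hP]; simp [hzM], by simp [hzL]⟩) (by
          intro h
          have h1 := h.congr (v := P) (by rw [hUdef, restrict_restrict_of_subset hsub])
          rw [hP] at h1
          exact h1.not_mem hzx (by simp) hzM)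
      exact hE.derives_of_instances ⟨hxy, hxU, hyU, hxV, hyV, hUV, hcountU, hcountV, hsat⟩ hxP
        hnlin hleft (hright hN)
    · push Not at hN
      obtain ⟨hN, hNm⟩ := hN
      have hres : restrict (insert x (insert y (L.filter (· ∈ P)))) (U ++ [x, y] ++ V) =
          U ++ [x] ++ pw y (N.count y + 2) := by
        rw [restrict_append, restrict_append, restrict_eq_self (u := U) (fun z hz => by
          obtain ⟨h1, h2⟩ := hmemU z hz
          simp only [Finset.mem_insert, Finset.mem_filter]
          rcases h2 with h2 | h2
          · exact .inl h2
          · exact .inr (.inr ⟨h2, h1⟩)), restrict_eq_self (u := [x, y]) (by simp),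
          restrict_eq_pw (u := V) (x := y) (fun z hz hz' => by
            obtain ⟨h1, h2⟩ := hmemV z hz
            simp only [Finset.mem_insert, Finset.mem_filter] at hz'
            rcases hz' with rfl | rfl | ⟨h3, h4⟩
            · exact absurd hz hxV
            · rfl
            · exact absurd h1 (hPQ z h3 h4)) (by simp)]
        have : V.count y = N.count y + 1 := by
          rw [hVdef, count_restrict_of_mem (by simp), hQy]
        rw [this, show N.count y + 2 = (N.count y + 1) + 1 from rfl, pw_succ y (N.count y + 1)]
        simp
      have hun := bUnstable_restrict (X := insert x (insert y (L.filter (· ∈ P)))) (by simp)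
        (by simp) hs hB hprec hp (by simp)
      rw [hres] at hun
      obtain ⟨c, hc0, hck, hsat⟩ := hE.condI (N.count y + 2) (by omega) (by omega) U x y t hxy htx
        hty hyU htU hxU (almostLinear_of_count_le (x := x) (fun z hz => by
          have := hcountU z hz
          simpa [List.count_cons, hz.symm] using this)) hun
      obtain ⟨c, rfl⟩ : ∃ c', c = c' + 1 := ⟨c - 1, by omega⟩
      obtain ⟨e, he⟩ : ∃ e, N.count y + 2 - (c + 1) = e + 1 := ⟨N.count y - c, by omega⟩
      rw [he, Nat.add_sub_cancel] at hsat
      have hsw : IsSwap S x y U (pw y c ++ [t] ++ pw y (e + 1)) := by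
        refine ⟨hxy, hxU, hyU, ?_, by simp, ?_, hcountU,
          fun z hz => count_pw_append_le hz, ?_⟩
        · simp [hxy, Ne.symm htx]
        · intro z hz
          have h1 : z ≠ t := fun h => htU (h ▸ hz)
          have h2 : z ≠ y := fun h => hyU (h ▸ hz)
          simp [h1, h2]
        · rw [pw_succ y c] at hsat
          simpa using hsat
      refine hE.derives_of_instances hsw hxP hnlin hleft ?_
      rw [hQ]
      exact hE.comm.rightInstance_pw hN hty (by omega)
  · push Not at hM
    by_cases hMm : m ≤ M.count x + 1
    · rw [hP]
      exact hE.last_first hyQ hMm (fun z hz => by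
        rw [← hP]
        exact hnlin z (.inl (by rw [hP]; simp [hz])) (hM z hz))
    · have hres : restrict (insert x (insert y (L.filter (· ∈ Q)))) (U ++ [x, y] ++ V) =
          pw x (M.count x + 2) ++ [y] ++ V := by
        rw [restrict_append, restrict_append, restrict_eq_self (u := V) (fun z hz => by
          obtain ⟨h1, h2⟩ := hmemV z hz
          simp only [Finset.mem_insert, Finset.mem_filter]
          rcases h2 with h2 | h2
          · exact .inr (.inl h2)
          · exact .inr (.inr ⟨h2, h1⟩)), restrict_eq_self (u := [x, y]) (by simp),
          restrict_eq_pw (u := U) (x := x) (fun z hz hz' => by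
            obtain ⟨h1, h2⟩ := hmemU z hz
            simp only [Finset.mem_insert, Finset.mem_filter] at hz'
            rcases hz' with rfl | rfl | ⟨h3, h4⟩
            · rfl
            · exact absurd hz hyU
            · exact absurd h4 (hPQ z h3 h1)) (by simp)]
        have : U.count x = M.count x + 1 := by
          rw [hUdef, count_restrict_of_mem (by simp), hPx]
        rw [this, show M.count x + 2 = (M.count x + 1) + 1 from rfl, pw_succ' x (M.count x + 1)]
        simp
      have hun := bUnstable_restrict (X := insert x (insert y (L.filter (· ∈ Q)))) (by simp)
        (by simp) hs hB hprec hp (by simp)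
      rw [hres] at hun
      obtain ⟨c, hc0, hck, hsat⟩ := hE.condII (M.count x + 2) (by omega) (by omega) V x y t hxy htx
        hty hxV htV hyV (almostLinear_of_count_le (x := y) (fun z hz => by
          have := hcountV z hz
          simpa [List.count_cons, hz.symm] using this)) hun
      obtain ⟨c, rfl⟩ : ∃ c', c = c' + 1 := ⟨c - 1, by omega⟩
      obtain ⟨e, he⟩ : ∃ e, M.count x + 2 - (c + 1) = e + 1 := ⟨M.count x - c, by omega⟩
      rw [he, Nat.add_sub_cancel] at hsat
      have hsw : IsSwap S x y (pw x (e + 1) ++ [t] ++ pw x c) V := by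
        refine ⟨hxy, by simp, ?_, hxV, hyV, ?_, fun z hz => count_pw_append_le hz,
          hcountV, ?_⟩
        · simp [hxy.symm, Ne.symm hty]
        · intro z hz hzV
          have h1 : z ≠ t := fun h => htV (h ▸ hzV)
          have h2 : z ≠ x := fun h => hxV (h ▸ hzV)
          simp [h1, h2] at hz
        · rw [pw_succ' x c] at hsat
          simpa using hsat
      refine hE.derives_of_instances hsw hxP hnlin ?_ (hright (.inr (by omega)))
      rw [hP]
      exact hE.comm.leftInstance_pw hM htx (by omega)

/-- All identities of `S` are derived from `E`. -/
theorem IsRichBasis.complete (hE : IsRichBasis S m E) (h : Satisfies S u v) : Derives E u v := by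
  obtain ⟨w, hw, hB⟩ := hE.exists_blockBalanced h
  refine hw.trans ?_
  have hcount : ∀ {P Q : Word} {x y : ℕ}, x ∈ P → y ∈ Q →
      (P ++ [x, y] ++ Q).count x ≠ 1 ∧ (P ++ [x, y] ++ Q).count y ≠ 1 := by
    intro P Q x y hx hy
    have h1 := List.count_pos_iff.2 hx
    have h2 := List.count_pos_iff.2 hy
    simp only [List.count_append, List.count_cons, List.count_nil, beq_self_eq_true, if_true]
    constructor <;> omega
  refine sort_blockBalanced (R := Derives E) (Inv := fun w => Satisfies S w v) .refl
    (fun h h' => h.trans h') (fun P Q x z hx hz => hE.comm.of_mem_right hx hz)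
    (fun P Q x z hx hz => hE.comm.of_mem_left hx hz)
    (fun hd hs => (hd.sound hE.sound).symm.trans hs) ?_ ?_ ((hw.sound hE.sound).symm.trans h) hB
  · intro P Q x y hxy hxP hxQ hyP hyQ hs hBB hp
    obtain ⟨h1, h2⟩ := hcount hxP hyQ
    have hsw := blockBalanced_swap P Q h1 h2
    have hBW := hsw.trans hBB
    have hres : restrict (insert x (insert y (lin (P ++ [x, y] ++ Q)))) v =
        restrict (insert x (insert y (lin (P ++ [x, y] ++ Q)))) (P ++ [x, y] ++ Q) := by
      have hpW : Precedes x y (P ++ [x, y] ++ Q) := by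
        have := precedes_append (P := P ++ [x]) (Q := [y] ++ Q) (x := x) (y := y)
          (by simp [hyP, hxy.symm]) (by simp [hxQ, hxy])
        simpa using this
      have hxypair := hp.restrict_eq hpW (fun z => (hBW.count_eq z).symm)
      have hlin : ∀ a b, (b ∈ lin (P ++ [x, y] ++ Q) ∨ b = a) →
          restrict {a, b} v = restrict {a, b} (P ++ [x, y] ++ Q) := by
        intro a b hb
        refine (restrict_eq_of_subset ?_ (hBW a)).symm
        intro c
        simp only [Finset.mem_insert, Finset.mem_singleton]
        rintro (rfl | rfl)
        · exact .inl rfl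
        · exact hb.symm
      apply restrict_eq_of_pairs
      intro a ha b hb
      by_cases hbL : b ∈ lin (P ++ [x, y] ++ Q) ∨ b = a
      · exact hlin a b hbL
      by_cases haL : a ∈ lin (P ++ [x, y] ++ Q) ∨ a = b
      · rw [Finset.pair_comm]
        exact hlin b a haL
      push Not at haL hbL
      simp only [Finset.mem_insert, haL.1, hbL.1, or_false] at ha hb
      rcases ha with rfl | rfl <;> rcases hb with rfl | rfl
      · exact absurd rfl hbL.2
      · exact hxypair
      · rw [Finset.pair_comm]; exact hxypair
      · exact absurd rfl hbL.2
    refine (hE.critical hxy hxP hxQ hyP hyQ ?_ (hsw.restrict _) ?_).symm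
    · have := hs.restrict (insert x (insert y (lin (P ++ [x, y] ++ Q))))
      rw [hres] at this
      exact this.symm
    · intro h
      refine not_precedes_swap (P := P) (Q := Q) hxy (h.congr ?_)
      rw [restrict_restrict_of_subset (by simp [Finset.insert_subset_iff])]
  · intro P Q x y hxy hxP hxQ hyP hyQ hs hBB hp
    refine hE.critical hxy hxP hxQ hyP hyQ (hs.restrict _) (hBB.restrict _) ?_
    intro h
    refine hp (h.congr ?_)
    rw [restrict_restrict_of_subset (by simp [Finset.insert_subset_iff])]

end Completeness

section Commutation

/-- The identities `σ₁`, `σ₂` and those obtained from them by deleting linear variables. -/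
def sigmaIdentities : Set (Word × Word) :=
  {([0, 1, 2, 0, 3, 1], [1, 0, 2, 0, 3, 1]), ([0, 1, 0, 3, 1], [1, 0, 0, 3, 1]),
    ([0, 1, 2, 0, 1], [1, 0, 2, 0, 1]), ([0, 1, 0, 1], [1, 0, 0, 1]),
    ([0, 2, 1, 3, 0, 1], [0, 2, 1, 3, 1, 0]), ([0, 1, 3, 0, 1], [0, 1, 3, 1, 0]),
    ([0, 2, 1, 0, 1], [0, 2, 1, 1, 0]), ([0, 1, 0, 1], [0, 1, 1, 0])}

theorem sigmaIdentities_finite : sigmaIdentities.Finite := by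
  unfold sigmaIdentities
  exact Set.toFinite _

theorem sigmaIdentities_subset {S : Type*} [Monoid S] (h1 : SatSigma1 S) (h2 : SatSigma2 S) :
    sigmaIdentities ⊆ equationalTheory S := by
  rintro p (rfl | rfl | rfl | rfl | rfl | rfl | rfl | rfl)
  · exact ⟨by simp, by simp, h1⟩
  · exact ⟨by simp, by simp, by simpa [restrict] using h1.restrict {0, 1, 3}⟩
  · exact ⟨by simp, by simp, by simpa [restrict] using h1.restrict {0, 1, 2}⟩
  · exact ⟨by simp, by simp, by simpa [restrict] using h1.restrict {0, 1}⟩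
  · exact ⟨by simp, by simp, h2⟩
  · exact ⟨by simp, by simp, by simpa [restrict] using h2.restrict {0, 1, 3}⟩
  · exact ⟨by simp, by simp, by simpa [restrict] using h2.restrict {0, 1, 2}⟩
  · exact ⟨by simp, by simp, by simpa [restrict] using h2.restrict {0, 1}⟩

theorem sigmaIdentities_blockBalanced : ∀ p ∈ sigmaIdentities,
    BlockBalanced p.1 p.2 ∧ (nonlin p.1).card = 2 ∧ (nonlin p.2).card = 2 := by
  rintro p (rfl | rfl | rfl | rfl | rfl | rfl | rfl | rfl)
  · exact ⟨blockBalanced_swap [] [2, 0, 3, 1] (by decide) (by decide), by decide, by decide⟩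
  · exact ⟨blockBalanced_swap [] [0, 3, 1] (by decide) (by decide), by decide, by decide⟩
  · exact ⟨blockBalanced_swap [] [2, 0, 1] (by decide) (by decide), by decide, by decide⟩
  · exact ⟨blockBalanced_swap [] [0, 1] (by decide) (by decide), by decide, by decide⟩
  · exact ⟨blockBalanced_swap [0, 2, 1, 3] [] (by decide) (by decide), by decide, by decide⟩
  · exact ⟨blockBalanced_swap [0, 1, 3] [] (by decide) (by decide), by decide, by decide⟩
  · exact ⟨blockBalanced_swap [0, 2, 1] [] (by decide) (by decide), by decide, by decide⟩
  · exact ⟨blockBalanced_swap [0, 1] [] (by decide) (by decide), by decide, by decide⟩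

variable {E : Set (Word × Word)}

theorem derives_sigma_one (hE : sigmaIdentities ⊆ E) (P Q q₁ q₂ : Word) (x z : ℕ) :
    Derives E (P ++ [x, z] ++ (q₁ ++ [x] ++ q₂ ++ [z] ++ Q))
      (P ++ [z, x] ++ (q₁ ++ [x] ++ q₂ ++ [z] ++ Q)) := by
  let θ : ℕ → Word := fun i =>
    if i = 0 then [x] else if i = 1 then [z] else if i = 2 then (if q₁ = [] then [x] else q₁)
    else (if q₂ = [] then [x] else q₂)
  have hθ : ∀ i, θ i ≠ [] := by
    intro i
    simp only [θ]
    split_ifs <;> simp [*]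
  rcases eq_or_ne q₁ [] with h₁ | h₁ <;> rcases eq_or_ne q₂ [] with h₂ | h₂
  · have := Derives.step (E := E) [0, 1, 0, 1] [1, 0, 0, 1] (hE (by simp [sigmaIdentities])) θ hθ P Q
    simpa [θ, h₁, h₂] using this
  · have := Derives.step (E := E) [0, 1, 0, 3, 1] [1, 0, 0, 3, 1] (hE (by simp [sigmaIdentities]))
      θ hθ P Q
    simpa [θ, h₁, h₂] using this
  · have := Derives.step (E := E) [0, 1, 2, 0, 1] [1, 0, 2, 0, 1] (hE (by simp [sigmaIdentities]))
      θ hθ P Q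
    simpa [θ, h₁, h₂] using this
  · have := Derives.step (E := E) [0, 1, 2, 0, 3, 1] [1, 0, 2, 0, 3, 1]
      (hE (by simp [sigmaIdentities])) θ hθ P Q
    simpa [θ, h₁, h₂] using this

theorem derives_sigma_two (hE : sigmaIdentities ⊆ E) (P Q p₁ p₂ : Word) (x z : ℕ) :
    Derives E (P ++ [x] ++ p₁ ++ [z] ++ p₂ ++ [x, z] ++ Q)
      (P ++ [x] ++ p₁ ++ [z] ++ p₂ ++ [z, x] ++ Q) := by
  let θ : ℕ → Word := fun i =>
    if i = 0 then [x] else if i = 1 then [z] else if i = 2 then (if p₁ = [] then [x] else p₁)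
    else (if p₂ = [] then [x] else p₂)
  have hθ : ∀ i, θ i ≠ [] := by
    intro i
    simp only [θ]
    split_ifs <;> simp [*]
  rcases eq_or_ne p₁ [] with h₁ | h₁ <;> rcases eq_or_ne p₂ [] with h₂ | h₂
  · have := Derives.step (E := E) [0, 1, 0, 1] [0, 1, 1, 0] (hE (by simp [sigmaIdentities])) θ hθ P Q
    simpa [θ, h₁, h₂] using this
  · have := Derives.step (E := E) [0, 1, 3, 0, 1] [0, 1, 3, 1, 0] (hE (by simp [sigmaIdentities]))
      θ hθ P Q
    simpa [θ, h₁, h₂] using this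
  · have := Derives.step (E := E) [0, 2, 1, 0, 1] [0, 2, 1, 1, 0] (hE (by simp [sigmaIdentities]))
      θ hθ P Q
    simpa [θ, h₁, h₂] using this
  · have := Derives.step (E := E) [0, 2, 1, 3, 0, 1] [0, 2, 1, 3, 1, 0]
      (hE (by simp [sigmaIdentities])) θ hθ P Q
    simpa [θ, h₁, h₂] using this

theorem exists_eq_append_pair {x z : ℕ} {Q : Word} (hx : x ∈ Q) (hz : z ∈ Q) (hxz : x ≠ z) :
    (∃ q₁ q₂ q₃, Q = q₁ ++ [x] ++ q₂ ++ [z] ++ q₃) ∨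
      ∃ q₁ q₂ q₃, Q = q₁ ++ [z] ++ q₂ ++ [x] ++ q₃ := by
  obtain ⟨p, q, rfl⟩ := List.append_of_mem hx
  rcases List.mem_append.1 hz with hz | hz
  · obtain ⟨p₁, p₂, rfl⟩ := List.append_of_mem hz
    exact .inr ⟨p₁, p₂, q, by simp⟩
  · rcases List.mem_cons.1 hz with rfl | hz
    · exact absurd rfl hxz
    · obtain ⟨p₁, p₂, rfl⟩ := List.append_of_mem hz
      exact .inl ⟨p, p₁, p₂, by simp⟩

theorem commutes_of_sigmaIdentities_subset (hE : sigmaIdentities ⊆ E) : Commutes E where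
  of_mem_right {P Q x z} hx hz := by
    rcases eq_or_ne x z with rfl | hxz
    · exact .refl _
    rcases exists_eq_append_pair hx hz hxz with ⟨q₁, q₂, q₃, rfl⟩ | ⟨q₁, q₂, q₃, rfl⟩
    · exact derives_sigma_one hE P q₃ q₁ q₂ x z
    · exact (derives_sigma_one hE P q₃ q₁ q₂ z x).symm
  of_mem_left {P Q x z} hx hz := by
    rcases eq_or_ne x z with rfl | hxz
    · exact .refl _
    rcases exists_eq_append_pair hx hz hxz with ⟨p₁, p₂, p₃, rfl⟩ | ⟨p₁, p₂, p₃, rfl⟩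
    · exact derives_sigma_two hE p₁ Q p₂ p₃ x z
    · exact (derives_sigma_two hE p₁ Q p₂ p₃ z x).symm

end Commutation

section Main

variable {S : Type*} [Monoid S] {m : ℕ} {u v : Word}

/-- `E` is a finite basis of identities of `S` consisting of almost-linear identities and of
block-balanced identities with two non-linear variables. -/
def IsGoodBasis (S : Type*) [Monoid S] (E : Set (Word × Word)) : Prop :=
  IsFiniteBasis S E ∧ ∀ p ∈ E, (AlmostLinear p.1 ∧ AlmostLinear p.2) ∨
    (BlockBalanced p.1 p.2 ∧ (nonlin p.1).card = 2 ∧ (nonlin p.2).card = 2)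

theorem exists_isGoodBasis (h1 : SatSigma1 S) (h2 : SatSigma2 S) (hm : 0 < m)
    (hiso : Isoterm S (pw 0 m ++ pw 1 m)) {d : ℕ} (hd : 0 < d) (hdm : d ≤ m)
    (hswap : Satisfies S (pw 0 (m + 1 - d) ++ [2] ++ pw 0 d ++ [1, 3, 1])
      (pw 0 (m + 1 - d) ++ [2] ++ pw 0 (d - 1) ++ [1, 0, 3, 1]))
    (hi : ∀ k, 1 < k → k ≤ m → CondI S k) (hii : ∀ k, 1 < k → k ≤ m → CondII S k) :
    ∃ E, IsGoodBasis S E := by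
  obtain ⟨E₁, hfin₁, hsub₁, hal, hder₁⟩ := exists_finite_almostLinear_basis hm hiso
  obtain ⟨E₂, hfin₂, hsub₂, hbb, hder₂⟩ := exists_finite_swap_basis S
  have hsub : E₁ ∪ E₂ ∪ sigmaIdentities ⊆ equationalTheory S :=
    Set.union_subset (Set.union_subset hsub₁ hsub₂) (sigmaIdentities_subset h1 h2)
  have hrich : IsRichBasis S m (E₁ ∪ E₂ ∪ sigmaIdentities) :=
    { pos := hm
      iso := hiso
      sound := hsub
      comm := commutes_of_sigmaIdentities_subset Set.subset_union_right
      swap := fun x y u v h => (hder₂ x y u v h).mono fun p hp => .inl (.inr hp)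
      almostLinear := fun h h' hne ha hs => (hder₁ h h' hne ha hs).mono fun p hp => .inl (.inl hp)
      exists_swap := ⟨d, hd, hdm, hswap⟩
      condI := hi
      condII := hii }
  refine ⟨E₁ ∪ E₂ ∪ sigmaIdentities, ⟨(hfin₁.union hfin₂).union sigmaIdentities_finite, hsub,
    fun p hp => hrich.complete hp.2.2⟩, ?_⟩
  rintro p ((hp | hp) | hp)
  · exact .inl (hal p hp)
  · exact .inr (hbb p hp)
  · exact .inr (sigmaIdentities_blockBalanced p hp)

theorem satisfies_op_iff : Satisfies Sᵐᵒᵖ u v ↔ Satisfies S u.reverse v.reverse := by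
  have key : ∀ (φ : ℕ → Sᵐᵒᵖ) (w : Word),
      (w.reverse.map fun x => (φ x).unop).prod = ((w.map φ).prod).unop := by
    intro φ w
    rw [MulOpposite.unop_list_prod, List.map_reverse, List.map_map]
    rfl
  constructor
  · intro h φ
    have := h fun x => MulOpposite.op (φ x)
    have h1 := key (fun x => MulOpposite.op (φ x))
    simp only [MulOpposite.unop_op] at h1
    rw [h1, h1, this]
  · intro h φ
    apply MulOpposite.unop_injective
    rw [← key, ← key]
    exact h _

theorem lin_reverse : lin u.reverse = lin u := lin_eq_of_count_eq (by simp)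

theorem nonlin_reverse : nonlin u.reverse = nonlin u := nonlin_eq_of_perm (List.reverse_perm u)

theorem restrict_reverse (X : Finset ℕ) : restrict X u.reverse = (restrict X u).reverse := by
  simp [restrict]

theorem AlmostLinear.reverse (h : AlmostLinear u) : AlmostLinear u.reverse := by
  rwa [AlmostLinear, nonlin_reverse]

theorem BlockBalanced.reverse (h : BlockBalanced u v) : BlockBalanced u.reverse v.reverse := by
  intro x
  rw [lin_reverse, restrict_reverse, restrict_reverse, h x]

theorem BUnstable.of_op {x y : ℕ} (h : BUnstable Sᵐᵒᵖ x y u) : BUnstable S x y u.reverse := by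
  obtain ⟨v, hv, hs, hB, hne⟩ := h
  refine ⟨v.reverse, by simpa using hv, satisfies_op_iff.1 hs, hB.reverse, ?_⟩
  rw [restrict_reverse, restrict_reverse]
  exact fun h => hne (List.reverse_injective h)

theorem bUnstable_pair_comm {x y : ℕ} (h : BUnstable S x y u) : BUnstable S y x u := by
  obtain ⟨v, hv, hs, hB, hne⟩ := h
  exact ⟨v, hv, hs, hB, by rwa [Finset.pair_comm]⟩

theorem CondII.condI_op {k : ℕ} (h : CondII S k) : CondI Sᵐᵒᵖ k := by
  intro A x y t hxy htx hty hyA htA hxA hal hun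
  obtain ⟨p, hp0, hpk, hs⟩ := h A.reverse y x t hxy.symm hty htx (by simpa using hyA)
    (by simpa using htA) (by simpa using hxA) (by simpa using hal.reverse)
    (by simpa [pw] using bUnstable_pair_comm hun.of_op)
  refine ⟨p, hp0, hpk, satisfies_op_iff.2 ?_⟩
  simpa [pw] using hs

theorem CondI.condII_op {k : ℕ} (h : CondI S k) : CondII Sᵐᵒᵖ k := by
  intro B x y t hxy htx hty hxB htB hyB hal hun
  obtain ⟨c, hc0, hck, hs⟩ := h B.reverse y x t hxy.symm hty htx (by simpa using hxB)
    (by simpa using htB) (by simpa using hyB) (by simpa using hal.reverse)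
    (by simpa [pw] using bUnstable_pair_comm hun.of_op)
  refine ⟨c, hc0, hck, satisfies_op_iff.2 ?_⟩
  simpa [pw] using hs

/-- Renaming of variables that turns `σ₁` and `σ₂` into the reversals of each other. -/
def mirror : ℕ → ℕ
  | 0 => 1
  | 1 => 0
  | 2 => 3
  | 3 => 2
  | n + 4 => n + 4

theorem mirror_mirror (n : ℕ) : mirror (mirror n) = n := by
  match n with
  | 0 | 1 | 2 | 3 => rfl
  | n + 4 => rfl

theorem Isoterm.op (h : Isoterm S (pw 0 m ++ pw 1 m)) : Isoterm Sᵐᵒᵖ (pw 0 m ++ pw 1 m) := by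
  intro v hv hs
  have h1 := (satisfies_op_iff.1 hs).map mirror
  have e : (pw 0 m ++ pw 1 m).reverse.map mirror = pw 0 m ++ pw 1 m := by simp [pw, mirror]
  rw [e] at h1
  have h2 := h _ (by simpa using hv) h1
  have h3 := congrArg (fun w => (w.map mirror).reverse) h2
  have e1 : (v.reverse.map mirror).map mirror = v.reverse := by
    rw [List.map_map, show mirror ∘ mirror = id from funext mirror_mirror, List.map_id]
  have e2 : ((pw 0 m ++ pw 1 m).map mirror).reverse = pw 0 m ++ pw 1 m := by simp [pw, mirror]
  simp only [e1, e2, List.reverse_reverse] at h3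
  exact h3

theorem exists_isGoodBasis_of_op {E : Set (Word × Word)} (hE : IsGoodBasis Sᵐᵒᵖ E) :
    ∃ E, IsGoodBasis S E := by
  obtain ⟨⟨hfin, hsub, hder⟩, hgood⟩ := hE
  refine ⟨(fun p : Word × Word => (p.1.reverse, p.2.reverse)) '' E, ⟨hfin.image _, ?_, ?_⟩, ?_⟩
  · rintro _ ⟨p, hp, rfl⟩
    obtain ⟨h1, h2, h3⟩ := hsub hp
    exact ⟨by simpa using h1, by simpa using h2, satisfies_op_iff.1 h3⟩
  · rintro ⟨u, v⟩ ⟨h1, h2, h3⟩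
    have := (hder (u.reverse, v.reverse) ⟨by simpa using h1, by simpa using h2,
      satisfies_op_iff.2 (by simpa using h3)⟩).reverse
    simpa using this
  · rintro _ ⟨p, hp, rfl⟩
    rcases hgood p hp with ⟨h1, h2⟩ | ⟨h1, h2, h3⟩
    · exact .inl ⟨h1.reverse, h2.reverse⟩
    · exact .inr ⟨h1.reverse, by rwa [nonlin_reverse], by rwa [nonlin_reverse]⟩

end Main

end WordIdentities

theorem mainTheorem7 {S : Type*} [Monoid S]
    (h1 : WordIdentities.SatSigma1 S) (h2 : WordIdentities.SatSigma2 S)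
    (m : ℕ) (hm : 0 < m)
    (hiso : WordIdentities.Isoterm S (WordIdentities.pw 0 m ++ WordIdentities.pw 1 m))
    (d : ℕ) (hd : 0 < d) (hdm : d ≤ m)
    (hswap :
      WordIdentities.Satisfies S
        (WordIdentities.pw 0 (m + 1 - d) ++ [2] ++ WordIdentities.pw 0 d ++ [1, 3, 1])
        (WordIdentities.pw 0 (m + 1 - d) ++ [2] ++ WordIdentities.pw 0 (d - 1) ++ [1, 0, 3, 1]) ∨
      WordIdentities.Satisfies S
        ([0, 2, 0] ++ WordIdentities.pw 1 d ++ [3] ++ WordIdentities.pw 1 (m + 1 - d))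
        ([0, 2, 1, 0] ++ WordIdentities.pw 1 (d - 1) ++ [3] ++ WordIdentities.pw 1 (m + 1 - d)))
    (hi : 1 < m → ∀ k, 1 < k → k ≤ m → WordIdentities.CondI S k)
    (hii : 1 < m → ∀ k, 1 < k → k ≤ m → WordIdentities.CondII S k) :
    ∃ E : Set (WordIdentities.Word × WordIdentities.Word),
      WordIdentities.IsFiniteBasis S E ∧
      ∀ p ∈ E,
        (WordIdentities.AlmostLinear p.1 ∧ WordIdentities.AlmostLinear p.2) ∨
        (WordIdentities.BlockBalanced p.1 p.2 ∧
          (WordIdentities.nonlin p.1).card = 2 ∧ (WordIdentities.nonlin p.2).card = 2) := by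
  have hi' : ∀ k, 1 < k → k ≤ m → WordIdentities.CondI S k := fun k hk hkm =>
    hi (hk.trans_le hkm) k hk hkm
  have hii' : ∀ k, 1 < k → k ≤ m → WordIdentities.CondII S k := fun k hk hkm =>
    hii (hk.trans_le hkm) k hk hkm
  rcases hswap with hswap | hswap
  · exact WordIdentities.exists_isGoodBasis h1 h2 hm hiso hd hdm hswap hi' hii'
  · obtain ⟨E, hE⟩ := WordIdentities.exists_isGoodBasis (S := Sᵐᵒᵖ) (m := m) (d := d)
      (WordIdentities.satisfies_op_iff.2 (h2.map WordIdentities.mirror))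
      (WordIdentities.satisfies_op_iff.2 (h1.map WordIdentities.mirror)) hm hiso.op hd hdm
      (WordIdentities.satisfies_op_iff.2 (by
        simpa [WordIdentities.pw, WordIdentities.mirror] using hswap.map WordIdentities.mirror))
      (fun k hk hkm => (hii' k hk hkm).condI_op) (fun k hk hkm => (hi' k hk hkm).condII_op)
    exact WordIdentities.exists_isGoodBasis_of_op hE
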